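/- \textbf{Setting.} A \emph{program} has Boolean variables $b\in\{0,1\}^n$, rational variables $x\in\mathbb{Q}^m$, an initial state $(b^0,x^0)$ and a transition relation $\exists y\in\mathbb{Q}^E\,\exists p\in\{0,1\}^d.\ T$, where $T$ is a quantifier-free formula in negation normal form whose atoms are Boolean literals over $b,b',p$ and linear constraints $\sum_i\alpha_i x_i+\sum_i\alpha'_i x'_i+\sum_i\beta_i y_i\bowtie c$ with rational constants and $\bowtie\in\{\le,<,=\}$ ($b',x'$ denote the state after the transition). A \emph{template} is a matrix $A\in\mathbb{Q}^{\ell\times m}$. The \emph{partitioned template domain} is the set of maps $\rho:\{0,1\}^n\to(\mathbb{Q}\cup\{\pm\infty\})^\ell$, ordered pointwise, with $\gamma(\rho)=\{(b,x) : Ax\le\rho(b)\}$. The map $\rho$ is an \emph{inductive invariant} if $(b^0,x^0)\in\gamma(\rho)$ and $\gamma(\rho)$ is closed under transitions. An \emph{instance} consists of a program, a template and a bad state $(b^*,x^*)$. It is written as a string with rational constants in binary and numbers of variables and of rows, and variable indices, in unary. \textbf{Theorem.} The following two decision problems are EXPTIME-hard under polynomial-time many-one reductions: (a) given an instance, does the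 program have a least inductive invariant $\rho$ with $(b^*,x^*)\notin\gamma(\rho)$? (b) given an instance, is there an inductive invariant $\rho$ with $(b^*,x^*)\notin\gamma(\rho)$? More precisely, let $L\subseteq\{0,1\}^*$ be decided by a deterministic single-tape Turing machine $\mathcal{M}$ in time $2^{P(|w|)}$, where $P$ is a polynomial with natural coefficients. Then there are a polynomial-time computable map $w\mapsto f(w)$ from strings to instances and a constant $k$, which do not depend on $w$, such that for every $w$: 1. the instance $f(w)$ has length at most $k\,(P(|w|)+|w|+1)$ (variables counting once, rational constants by bit length), and it has at most $P(|w|)+k$ Boolean variables; 2. the program of $f(w)$ has exactly two rational variables and no variables $y$; in $T$ every disjunction that contains a linear constraint has the form $(p_i\wedge F)\vee(\neg p_i\wedge G)$; every state has at most one successor; and there is a set of at most $k$ affine maps such that every transition updates $x$ by one of them; 3. there is a set of at most $P(|w|)+k$ Boolean variables (a counter) whose joint value differs in any two different reachable states; 4. the template of $f(w)$ is the interval template (its rows are $x\mapsto x_j$ and $x\mapsto -x_j$ for all $j$); 5. the program has a least inductive invariant $\rho$ in the partitioned interval domain, it is exact, i.e. $\gamma(\rho)$ is the set of reachable states of the program,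 and $w\in L$ if and only if $(b^*,x^*)\notin\gamma(\rho)$. -/

import Mathlib

namespace PartitionedTemplates

/-! ### Programs with Boolean and rational state -/

/-- Propositional variables of a transition formula: Boolean state before (`pre`) and after (`post`)
the transition, and existentially quantified path choices (`choice`). -/
inductive BoolVar (nb np : ℕ) where
  | pre (i : Fin nb)
  | post (i : Fin nb)
  | choice (i : Fin np)

/-- The comparison symbols of linear atoms. -/
inductive Cmp where
  | le
  | lt
  | eq

/-- Meaning of a comparison symbol. -/
def Cmp.Holds : Cmp → ℚ → ℚ → Prop
  | .le, u, v => u ≤ v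
  | .lt, u, v => u < v
  | .eq, u, v => u = v

/-- Quantifier-free formulas in negation normal form. `lit v true` is the literal `v`, `lit v false`
is `¬ v`; `lin a a' e r c` is the atom `∑ aᵢ xᵢ + ∑ a'ᵢ x'ᵢ + ∑ eᵢ yᵢ r c`. -/
inductive Formula (nb nx ny np : ℕ) where
  | lit (v : BoolVar nb np) (positive : Bool)
  | lin (a a' : Fin nx → ℚ) (e : Fin ny → ℚ) (r : Cmp) (c : ℚ)
  | and (F G : Formula nb nx ny np)
  | or (F G : Formula nb nx ny np)

/-- A state `(b, x)`: Boolean state and numeric state. -/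
abbrev State (nb nx : ℕ) : Type := (Fin nb → Bool) × (Fin nx → ℚ)

/-- Value of a propositional variable. -/
def BoolVar.val {nb np : ℕ} (b b' : Fin nb → Bool) (p : Fin np → Bool) : BoolVar nb np → Bool
  | .pre i => b i
  | .post i => b' i
  | .choice i => p i

namespace Formula

variable {nb nx ny np : ℕ}

/-- Satisfaction `(s, t, p, y) ⊨ F` for a departure state `s` and an arrival state `t`. -/
def Sat (s t : State nb nx) (p : Fin np → Bool) (y : Fin ny → ℚ) :
    Formula nb nx ny np → Prop
  | lit v positive => v.val s.1 t.1 p = positive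
  | lin a a' e r c =>
      r.Holds ((∑ i, a i * s.2 i) + (∑ i, a' i * t.2 i) + ∑ i, e i * y i) c
  | and F G => F.Sat s t p y ∧ G.Sat s t p y
  | or F G => F.Sat s t p y ∨ G.Sat s t p y

/-- The formula contains no linear atom. -/
def IsPropositional : Formula nb nx ny np → Prop
  | lit _ _ => True
  | lin _ _ _ _ _ => False
  | and F G => F.IsPropositional ∧ G.IsPropositional
  | or F G => F.IsPropositional ∧ G.IsPropositional

/-- Every disjunction that contains a linear atom is resolved by a path-choice variable:
it has the form `(pᵢ ∧ F') ∨ (¬ pᵢ ∧ G')`. -/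
def Guarded : Formula nb nx ny np → Prop
  | lit _ _ => True
  | lin _ _ _ _ _ => True
  | and F G => F.Guarded ∧ G.Guarded
  | or F G => F.Guarded ∧ G.Guarded ∧
      ((F.IsPropositional ∧ G.IsPropositional) ∨
        ∃ (i : Fin np) (F' G' : Formula nb nx ny np),
          F = and (lit (.choice i) true) F' ∧ G = and (lit (.choice i) false) G')

end Formula

/-- A transition system: Boolean variables `b`, rational variables `x`, the quantifier-free part `T`
of the transition relation `∃ y ∈ ℚ^ny, ∃ p ∈ 𝔹^np, T`, and an initial state. -/
structure Program where
  nb : ℕ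
  nx : ℕ
  ny : ℕ
  np : ℕ
  T : Formula nb nx ny np
  b₀ : Fin nb → Bool
  x₀ : Fin nx → ℚ

namespace Program

/-- The initial state. -/
def init (P : Program) : State P.nb P.nx := (P.b₀, P.x₀)

/-- The transition relation. -/
def Step (P : Program) (s t : State P.nb P.nx) : Prop :=
  ∃ (y : Fin P.ny → ℚ) (p : Fin P.np → Bool), P.T.Sat s t p y

/-- The set of states reachable in concrete executions. -/
def reachable (P : Program) : Set (State P.nb P.nx) :=
  {s | Relation.ReflTransGen P.Step P.init s}

/-- Every state has at most one successor. -/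
def Deterministic (P : Program) : Prop :=
  ∀ s t t', P.Step s t → P.Step s t' → t = t'

/-- Every transition updates the numeric state by one of at most `k` affine maps. -/
def HasAffineUpdates (P : Program) (k : ℕ) : Prop :=
  ∃ U : Finset ((Fin P.nx → ℚ) →ᵃ[ℚ] (Fin P.nx → ℚ)), U.card ≤ k ∧
    ∀ s t, P.Step s t → ∃ g ∈ U, t.2 = g s.2

/-- There is a group of at most `k` Boolean variables (a counter) whose joint value is different in
any two different reachable states. -/
def HasSeparatingCounter (P : Program) (k : ℕ) : Prop :=
  ∃ S : Finset (Fin P.nb), S.card ≤ k ∧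
    ∀ s ∈ P.reachable, ∀ t ∈ P.reachable, (∀ i ∈ S, s.1 i = t.1 i) → s = t

end Program

/-! ### The partitioned template domain -/

/-- `ℚ ∪ {-∞, +∞}`. -/
abbrev ExtRat : Type := WithBot (WithTop ℚ)

/-- Embedding of `ℚ` in `ℚ ∪ {-∞, +∞}`. -/
def ExtRat.ofRat (q : ℚ) : ExtRat := ((q : WithTop ℚ) : WithBot (WithTop ℚ))

/-- Abstract values: a vector of `nrow` bounds for every Boolean state, ordered pointwise. -/
abbrev AbstractValue (nb nrow : ℕ) : Type := (Fin nb → Bool) → Fin nrow → ExtRat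

/-- The states `(b, x)` with `A x ≤ ρ(b)` coordinatewise. In particular there is none at `b` if some
coordinate of `ρ(b)` is `-∞`. -/
def concretization {nb nx nrow : ℕ} (A : Matrix (Fin nrow) (Fin nx) ℚ)
    (ρ : AbstractValue nb nrow) : Set (State nb nx) :=
  {s | ∀ i, ExtRat.ofRat (A.mulVec s.2 i) ≤ ρ s.1 i}

/-- `ρ` contains the initial state and is stable under transitions. -/
def IsInductiveInvariant (P : Program) {nrow : ℕ} (A : Matrix (Fin nrow) (Fin P.nx) ℚ)
    (ρ : AbstractValue P.nb nrow) : Prop :=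
  P.init ∈ concretization A ρ ∧
    ∀ s t, s ∈ concretization A ρ → P.Step s t → t ∈ concretization A ρ

/-- The interval template: the rows are `x ↦ xⱼ` and `x ↦ -xⱼ`, for all coordinates `j`. -/
def IsIntervalTemplate {nx nrow : ℕ} (A : Matrix (Fin nrow) (Fin nx) ℚ) : Prop :=
  (∀ i, ∃ j, A i = Pi.single j 1 ∨ A i = Pi.single j (-1)) ∧
    ∀ j, (∃ i, A i = Pi.single j 1) ∧ ∃ i, A i = Pi.single j (-1)

/-- Instances of the invariant problem: a program, a template and a bad state. -/
structure AnalysisInstance where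
  prog : Program
  nrow : ℕ
  A : Matrix (Fin nrow) (Fin prog.nx) ℚ
  bad : State prog.nb prog.nx

namespace AnalysisInstance

/-- `ρ` is the least inductive invariant in the partitioned template domain. -/
def IsLeastInvariant (I : AnalysisInstance) (ρ : AbstractValue I.prog.nb I.nrow) : Prop :=
  IsLeast {ρ' | IsInductiveInvariant I.prog I.A ρ'} ρ

end AnalysisInstance

/-- The decision problem: does the least inductive invariant exclude the bad state? -/
def LeastInvariantExcludesBad : Set AnalysisInstance :=
  {I | ∃ ρ, I.IsLeastInvariant ρ ∧ I.bad ∉ concretization I.A ρ}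

/-- The decision problem: is there an inductive invariant that excludes the bad state? -/
def SomeInvariantExcludesBad : Set AnalysisInstance :=
  {I | ∃ ρ, IsInductiveInvariant I.prog I.A ρ ∧ I.bad ∉ concretization I.A ρ}

/-! ### Length of programs: variables count once, rational constants by their bit length -/

/-- Bit length of a rational number (sign, numerator, denominator). -/
def ratLength (q : ℚ) : ℕ := 1 + Nat.size q.num.natAbs + Nat.size q.den

/-- Length of a formula. -/
def Formula.length {nb nx ny np : ℕ} : Formula nb nx ny np → ℕ
  | lit _ _ => 1
  | lin a a' e _ c =>
      1 + (∑ i, ratLength (a i)) + (∑ i, ratLength (a' i)) + (∑ i, ratLength (e i)) + ratLength c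
  | and F G => 1 + F.length + G.length
  | or F G => 1 + F.length + G.length

/-- Length of a program: its variables, transition formula and initial state. -/
def Program.length (P : Program) : ℕ :=
  P.nb + P.nx + P.ny + P.np + P.T.length + P.nb + ∑ i, ratLength (P.x₀ i)

/-- Length of an instance: program, template and bad state. -/
def AnalysisInstance.length (I : AnalysisInstance) : ℕ :=
  I.prog.length + I.nrow + (∑ i, ∑ j, ratLength (I.A i j)) +
    I.prog.nb + ∑ i, ratLength (I.bad.2 i)

/-! ### Instances as strings

Numbers of variables and of rows, and variable indices, are in unary; rational constants are in
binary; formulas are in prefix notation. -/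

/-- The alphabet for instances. -/
inductive Token where
  | zero
  | one
  | sep
  | pre
  | post
  | choice
  | pos
  | neg
  | le
  | lt
  | eq
  | lin
  | and
  | or
  deriving DecidableEq

instance : Fintype Token where
  elems := {.zero, .one, .sep, .pre, .post, .choice, .pos, .neg, .le, .lt, .eq, .lin, .and, .or}
  complete := by intro a; cases a <;> simp

/-- Truth values. -/
def encBool (b : Bool) : List Token := [if b then .one else .zero]

/-- Natural numbers in unary. -/
def encUnary (n : ℕ) : List Token := List.replicate n .one ++ [.sep]

/-- Natural numbers in binary, least significant bit first. -/
def encBinary (n : ℕ) : List Token := n.bits.flatMap encBool ++ [.sep]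

/-- Rational numbers: sign, absolute value of the numerator, denominator. -/
def encRat (q : ℚ) : List Token :=
  (if q.num < 0 then .neg else .pos) :: (encBinary q.num.natAbs ++ encBinary q.den)

/-- Vectors of a known length, entry by entry. -/
def encVec {α : Type} (e : α → List Token) {n : ℕ} (v : Fin n → α) : List Token :=
  (List.ofFn v).flatMap e

/-- Propositional variables. -/
def encBoolVar {nb np : ℕ} : BoolVar nb np → List Token
  | .pre i => .pre :: encUnary i
  | .post i => .post :: encUnary i
  | .choice i => .choice :: encUnary i

/-- Comparison symbols. -/
def encCmp : Cmp → List Token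
  | .le => [.le]
  | .lt => [.lt]
  | .eq => [.eq]

/-- Formulas. -/
def encFormula {nb nx ny np : ℕ} : Formula nb nx ny np → List Token
  | .lit v true => .pos :: encBoolVar v
  | .lit v false => .neg :: encBoolVar v
  | .lin a a' e r c =>
      .lin :: (encVec encRat a ++ (encVec encRat a' ++ (encVec encRat e ++ (encCmp r ++ encRat c))))
  | .and F G => .and :: (encFormula F ++ encFormula G)
  | .or F G => .or :: (encFormula F ++ encFormula G)

/-- Programs. -/
def encProgram (P : Program) : List Token :=
  encUnary P.nb ++ (encUnary P.nx ++ (encUnary P.ny ++ (encUnary P.np ++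
    (encFormula P.T ++ (encVec encBool P.b₀ ++ encVec encRat P.x₀)))))

/-- Instances. -/
def encInstance (I : AnalysisInstance) : List Token :=
  encProgram I.prog ++ (encUnary I.nrow ++ (encVec (encVec encRat) I.A ++
    (encVec encBool I.bad.1 ++ encVec encRat I.bad.2)))

/-- Codes can be read off uniquely from the front of a string. -/
def UniquelyReadable {α : Type} (e : α → List Token) : Prop :=
  ∀ ⦃a b : α⦄ ⦃s t : List Token⦄, e a ++ s = e b ++ t → a = b ∧ s = t

theorem encBool_readable : UniquelyReadable encBool := by
  intro a b s t h
  cases a <;> cases b <;> simp_all [encBool]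

theorem encUnary_readable : UniquelyReadable encUnary := by
  intro a
  induction a with
  | zero =>
    intro b s t h
    cases b <;> simp_all [encUnary, List.replicate_succ]
  | succ a ih =>
    intro b s t h
    cases b with
    | zero => simp [encUnary, List.replicate_succ] at h
    | succ b =>
      have h' : encUnary a ++ s = encUnary b ++ t := by
        simpa [encUnary, List.replicate_succ] using h
      obtain ⟨h1, h2⟩ := ih h'
      exact ⟨by rw [h1], h2⟩

theorem bits_readable (u v : List Bool) (s t : List Token)
    (h : u.flatMap encBool ++ Token.sep :: s = v.flatMap encBool ++ Token.sep :: t) :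
    u = v ∧ s = t := by
  induction u generalizing v with
  | nil =>
    cases v with
    | nil => simpa using h
    | cons c v => cases c <;> simp [encBool] at h
  | cons a u ih =>
    cases v with
    | nil => cases a <;> simp [encBool] at h
    | cons c v =>
      simp only [List.flatMap_cons, List.append_assoc] at h
      obtain ⟨h1, h2⟩ := encBool_readable h
      obtain ⟨h3, h4⟩ := ih v h2
      exact ⟨by rw [h1, h3], h4⟩

theorem encBinary_readable : UniquelyReadable encBinary := by
  intro a b s t h
  simp only [encBinary, List.append_assoc, List.singleton_append] at h
  obtain ⟨h1, h2⟩ := bits_readable _ _ _ _ h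
  refine ⟨Nat.eq_of_testBit_eq fun i => ?_, h2⟩
  rw [Nat.testBit_eq_inth, Nat.testBit_eq_inth, h1]

theorem encRat_readable : UniquelyReadable encRat := by
  intro a b s t h
  simp only [encRat, List.cons_append, List.append_assoc, List.cons.injEq] at h
  obtain ⟨h0, h⟩ := h
  obtain ⟨h1, h⟩ := encBinary_readable h
  obtain ⟨h2, h⟩ := encBinary_readable h
  refine ⟨Rat.ext ?_ h2, h⟩
  split_ifs at h0 <;> omega

theorem encVec_readable {α : Type} {e : α → List Token} (he : UniquelyReadable e) (n : ℕ) :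
    UniquelyReadable (fun v : Fin n → α => encVec e v) := by
  induction n with
  | zero =>
    intro a b s t h
    exact ⟨Subsingleton.elim _ _, by simpa [encVec] using h⟩
  | succ n ih =>
    intro a b s t h
    simp only [encVec, List.ofFn_succ, List.flatMap_cons, List.append_assoc] at h
    obtain ⟨h1, h⟩ := he h
    obtain ⟨h2, h⟩ := ih h
    refine ⟨funext fun i => ?_, h⟩
    cases i using Fin.cases with
    | zero => exact h1
    | succ i => exact congrFun h2 i

theorem encBoolVar_readable {nb np : ℕ} : UniquelyReadable (encBoolVar (nb := nb) (np := np)) := by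
  intro a b s t h
  cases a <;> cases b <;> simp [encBoolVar] at h <;>
    · obtain ⟨h1, h2⟩ := encUnary_readable h
      exact ⟨by rw [Fin.ext h1], h2⟩

theorem encCmp_readable : UniquelyReadable encCmp := by
  intro a b s t h
  cases a <;> cases b <;> simp_all [encCmp]

theorem encFormula_readable {nb nx ny np : ℕ} :
    UniquelyReadable (encFormula (nb := nb) (nx := nx) (ny := ny) (np := np)) := by
  intro F
  induction F with
  | lit v q =>
    intro G s t h
    cases G with
    | lit w q' =>
      cases q <;> cases q' <;> simp [encFormula] at h <;>
        · obtain ⟨h1, h2⟩ := encBoolVar_readable h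
          exact ⟨by rw [h1], h2⟩
    | lin => cases q <;> simp [encFormula] at h
    | and => cases q <;> simp [encFormula] at h
    | or => cases q <;> simp [encFormula] at h
  | lin a a' e r c =>
    intro G s t h
    cases G with
    | lit w q' => cases q' <;> simp [encFormula] at h
    | lin =>
      simp only [encFormula, List.cons_append, List.append_assoc, List.cons.injEq, true_and] at h
      obtain ⟨h1, h⟩ := encVec_readable encRat_readable _ h
      obtain ⟨h2, h⟩ := encVec_readable encRat_readable _ h
      obtain ⟨h3, h⟩ := encVec_readable encRat_readable _ h
      obtain ⟨h4, h⟩ := encCmp_readable h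
      obtain ⟨h5, h⟩ := encRat_readable h
      exact ⟨by rw [h1, h2, h3, h4, h5], h⟩
    | and => simp [encFormula] at h
    | or => simp [encFormula] at h
  | and F₁ F₂ ih₁ ih₂ =>
    intro G s t h
    cases G with
    | lit w q' => cases q' <;> simp [encFormula] at h
    | lin => simp [encFormula] at h
    | and =>
      simp only [encFormula, List.cons_append, List.append_assoc, List.cons.injEq, true_and] at h
      obtain ⟨h1, h⟩ := ih₁ h
      obtain ⟨h2, h⟩ := ih₂ h
      exact ⟨by rw [h1, h2], h⟩
    | or => simp [encFormula] at h
  | or F₁ F₂ ih₁ ih₂ =>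
    intro G s t h
    cases G with
    | lit w q' => cases q' <;> simp [encFormula] at h
    | lin => simp [encFormula] at h
    | and => simp [encFormula] at h
    | or =>
      simp only [encFormula, List.cons_append, List.append_assoc, List.cons.injEq, true_and] at h
      obtain ⟨h1, h⟩ := ih₁ h
      obtain ⟨h2, h⟩ := ih₂ h
      exact ⟨by rw [h1, h2], h⟩

theorem encProgram_readable : UniquelyReadable encProgram := by
  rintro ⟨nb, nx, ny, np, T, b, x⟩ ⟨nb', nx', ny', np', T', b', x'⟩ s t h
  simp only [encProgram, List.append_assoc] at h
  obtain ⟨rfl, h_1⟩ := encUnary_readable h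
  obtain ⟨rfl, h_2⟩ := encUnary_readable h_1
  obtain ⟨rfl, h_3⟩ := encUnary_readable h_2
  obtain ⟨rfl, h_4⟩ := encUnary_readable h_3
  obtain ⟨rfl, h_5⟩ := encFormula_readable h_4
  obtain ⟨rfl, h_6⟩ := encVec_readable encBool_readable _ h_5
  obtain ⟨rfl, h_7⟩ := encVec_readable encRat_readable _ h_6
  exact ⟨rfl, h_7⟩

/-- Different instances have different codes. -/
theorem encInstance_injective : Function.Injective encInstance := by
  rintro ⟨P, r, A, b, x⟩ ⟨P', r', A', b', x'⟩ h
  have h : encInstance ⟨P, r, A, b, x⟩ ++ [] = encInstance ⟨P', r', A', b', x'⟩ ++ [] := by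
    rw [h]
  simp only [encInstance, List.append_assoc] at h
  obtain ⟨rfl, h_1⟩ := encProgram_readable h
  obtain ⟨rfl, h_2⟩ := encUnary_readable h_1
  obtain ⟨e1, h_3⟩ := encVec_readable (encVec_readable encRat_readable _) _ h_2
  obtain ⟨rfl, h_4⟩ := encVec_readable encBool_readable _ h_3
  obtain ⟨rfl, h_5⟩ := encVec_readable encRat_readable _ h_4
  subst e1
  rfl

/-! ### Exponential time and polynomial-time reductions -/

/-- A deterministic Turing machine with one two-way infinite tape, finitely many states and
accepting states. The tape symbols are the blank `none`, the input symbols `some (Sum.inl b)` and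
finitely many auxiliary symbols `some (Sum.inr a)`. -/
structure Decider where
  Aux : Type
  Q : Type
  [finiteAux : Finite Aux]
  [finiteQ : Finite Q]
  [inhabitedQ : Inhabited Q]
  M : Turing.TM0.Machine (Option (Bool ⊕ Aux)) Q
  accept : Set Q

attribute [instance] Decider.finiteAux Decider.finiteQ Decider.inhabitedQ

namespace Decider

/-- The initial configuration: the head is on the first symbol of the input. -/
def start (D : Decider) (w : List Bool) : Turing.TM0.Cfg (Option (Bool ⊕ D.Aux)) D.Q :=
  Turing.TM0.init (w.map fun b => some (Sum.inl b))

/-- On every input `w` the machine halts within `t |w|` steps, in an accepting state exactly when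
`w ∈ L`. -/
def DecidesInTime (D : Decider) (L : Language Bool) (t : ℕ → ℕ) : Prop :=
  ∀ w : List Bool, ∃ c : Turing.TM0.Cfg (Option (Bool ⊕ D.Aux)) D.Q,
    Nonempty (StateTransition.EvalsToInTime (Turing.TM0.step D.M) (D.start w) (some c)
      (t w.length)) ∧
    Turing.TM0.step D.M c = none ∧ (c.q ∈ D.accept ↔ w ∈ L)

end Decider

/-- The class EXPTIME: decidable in time `2 ^ P(n)` for a polynomial `P`. -/
def InExptime (L : Language Bool) : Prop :=
  ∃ (D : Decider) (P : Polynomial ℕ), D.DecidesInTime L fun n => 2 ^ P.eval n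

/-- `f` maps strings to instances and its code is computable in polynomial time. -/
def PolyTimeComputable (f : List Bool → AnalysisInstance) : Prop :=
  Nonempty (Turing.TM2ComputableInPolyTime (id : List Bool → List Bool) encInstance f)

/-- `Problem` is hard for EXPTIME under polynomial-time many-one reductions. -/
def ExptimeHard (Problem : Set AnalysisInstance) : Prop :=
  ∀ L : Language Bool, InExptime L →
    ∃ f : List Bool → AnalysisInstance, PolyTimeComputable f ∧ ∀ w, w ∈ L ↔ f w ∈ Problem

end PartitionedTemplates

open PartitionedTemplates

/-! The program simulates the Turing machine while its Boolean state counts the transitions. With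
blank coded by `0`, each half of the tape is read as a fraction `0.d₁d₂…` in base `B = 2 ^ width`:
the left half is one rational variable, the right half with the scanned symbol is the other. Moving
the head divides one fraction by `B` after adding a digit, and multiplies the other by `B` and
subtracts its leading digit. Writing changes a leading digit. Hence, once the control state, the
scanned symbol and the symbol to its left are fixed, a step is an affine map. There are finitely
many such cases, independent of the input, and path-choice variables select among them (`step_iff`,
`step_conf`).

Every transition increments a binary counter, and overflow blocks the transition. So a reachable
state is determined by its counter value (`reachable_unique`), and over each Boolean state at most
one numeric point is reachable. A point is a box, and the empty set is described by `-∞`. Therefore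
the interval domain represents the reachable set exactly. Since every inductive invariant contains
the reachable states, this representation is the least one (`exists_exact_leastInvariant`).

When the machine accepts, the program is stuck. When it rejects, the program sets both numbers to
`0`, enters an additional control state and idles there until the counter is full. So one fixed
state, rejecting with full counter, is reachable exactly if the machine rejects
(`bad_mem_reachable_iff`). Excluding it by some invariant and by the least one are equivalent,
because the least invariant excludes most.

For polynomial time, the code of the instance is decomposed into constant strings, runs of length
linear in `P(|w|)` or `|w|`, digits of the input, and counter gates that differ only in a unary
index (`encInstance_inst`). The symbol codes are chosen so that the fraction of the input word is
already reduced and its numerator is a concatenation of codes. A small loop language over stacks,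
compiled to Turing's stack machines with a time bound (`Runs.sound`), writes these pieces from the
last to the first. -/

namespace StackProgram

open Turing Function

/-! ### Loop programs over stacks and their compilation to stack machines -/

/-- Structured programs over stacks with alphabets `Γ k`. `forEach k body` pops stack `k` until it is
empty and runs `body g` for every popped symbol `g`. -/
inductive Cmd {K : Type} (Γ : K → Type) : Type
  | skip
  | push (k : K) (g : Γ k)
  | seq (c d : Cmd Γ)
  | forEach (k : K) (body : Γ k → Cmd Γ)

namespace Cmd

variable {K : Type} {Γ : K → Type}

/-- Program points. -/
def Lab : Cmd Γ → Type
  | skip => Unit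
  | push _ _ => Unit
  | seq c d => c.Lab ⊕ d.Lab
  | forEach k body => Option (Σ g : Γ k, (body g).Lab)

/-- The first program point. -/
def entry : (c : Cmd Γ) → c.Lab
  | skip => ()
  | push _ _ => ()
  | seq c _ => Sum.inl c.entry
  | forEach _ _ => none

theorem finite_lab [∀ k, Finite (Γ k)] (c : Cmd Γ) : Finite c.Lab := by
  induction c with
  | skip => exact inferInstanceAs (Finite Unit)
  | push => exact inferInstanceAs (Finite Unit)
  | seq c d hc hd => exact inferInstanceAs (Finite (c.Lab ⊕ d.Lab))
  | forEach k body h => exact inferInstanceAs (Finite (Option (Σ g : Γ k, (body g).Lab)))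

variable [DecidableEq K] {Λ : Type}

/-- The label after popping stack `k` in a loop. -/
def loopTarget (k : K) (next : Γ k → Λ) (exit : Λ) : Option (Σ k, Γ k) → Λ
  | none => exit
  -- The register can hold a symbol of any stack. Directly after stack `k` has been popped the tag
  -- is `k`, so the `else` branch is never taken by compiled code.
  | some ⟨k', g⟩ => if h : k' = k then next (h ▸ g) else exit

/-- Compilation to the statements of a stack machine, given a naming of the program points and the
label to continue with. -/
def code : (c : Cmd Γ) → (c.Lab → Λ) → Λ → c.Lab → TM2.Stmt Γ Λ (Option (Σ k, Γ k))
  | skip, _, exit, _ => .goto fun _ => exit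
  | push k g, _, exit, _ => .push k (fun _ => g) (.goto fun _ => exit)
  | seq c d, emb, exit, l =>
      match l with
      | .inl l => c.code (fun l => emb (.inl l)) (emb (.inr d.entry)) l
      | .inr l => d.code (fun l => emb (.inr l)) exit l
  | forEach k body, emb, exit, l =>
      match l with
      | none => .pop k (fun _ o => o.map (Sigma.mk k))
          (.goto (loopTarget k (fun g => emb (some ⟨g, (body g).entry⟩)) exit))
      | some ⟨g, l⟩ => (body g).code (fun l => emb (some ⟨g, l⟩)) (emb none) l

/-- `Runs c t S S'`: the program `c` transforms the stacks `S` into `S'` within `t` steps. -/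
inductive Runs : Cmd Γ → ℕ → (∀ k, List (Γ k)) → (∀ k, List (Γ k)) → Prop
  | skip (S) : Runs skip 1 S S
  | push (S) (k : K) (g : Γ k) : Runs (push k g) 1 S (update S k (g :: S k))
  | seq {c d t u S S₁ S₂} : Runs c t S S₁ → Runs d u S₁ S₂ → Runs (seq c d) (t + u) S S₂
  | forEach_nil {k body S} : S k = [] → Runs (forEach k body) 1 S S
  | forEach_cons {k body S S₁ S₂ g r t u} : S k = g :: r → Runs (body g) t (update S k r) S₁ →
      Runs (forEach k body) u S₁ S₂ → Runs (forEach k body) (t + u + 1) S S₂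
  | mono {c t u S S'} : Runs c t S S' → t ≤ u → Runs c u S S'

/-- Induction on the run. The exit label has to vary because a subprogram continues inside the
enclosing program. The register value can be arbitrary because a loop overwrites it by popping
before it branches on it. The machine `M` need only agree with the compiled code on the embedded
labels, which lets the hypothesis pass to subprograms. -/
theorem Runs.sound {c : Cmd Γ} {t : ℕ} {S S' : ∀ k, List (Γ k)} (h : Runs c t S S')
    (M : Λ → TM2.Stmt Γ Λ (Option (Σ k, Γ k))) (emb : c.Lab → Λ) (exit : Λ)
    (hM : ∀ l, M (emb l) = c.code emb exit l) (v : Option (Σ k, Γ k)) :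
    ∃ v', ∃ s ≤ t, (flip bind (TM2.step M))^[s] (some ⟨some (emb c.entry), v, S⟩) =
      some ⟨some exit, v', S'⟩ := by
  induction h generalizing exit v with
  | skip S =>
    refine ⟨v, 1, le_rfl, ?_⟩
    simp [flip, TM2.step, hM, code, TM2.stepAux]
  | push S k g =>
    refine ⟨v, 1, le_rfl, ?_⟩
    simp [flip, TM2.step, hM, code, TM2.stepAux]
  | @seq c d t u S S₁ S₂ _ _ ih₁ ih₂ =>
    obtain ⟨v₁, s₁, hs₁, h₁⟩ := ih₁ (fun l => emb (.inl l)) (emb (.inr d.entry))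
      (fun l => hM (.inl l)) v
    obtain ⟨v₂, s₂, hs₂, h₂⟩ := ih₂ (fun l => emb (.inr l)) exit (fun l => hM (.inr l)) v₁
    refine ⟨v₂, s₂ + s₁, by omega, ?_⟩
    rw [iterate_add_apply]
    exact (congrArg _ h₁).trans h₂
  | @forEach_nil k body S hk =>
    refine ⟨none, 1, le_rfl, ?_⟩
    have h0 := hM none
    have : update S k [] = S := by rw [← hk, update_eq_self]
    simp [flip, TM2.step, entry, h0, code, TM2.stepAux, hk, loopTarget, this]
  | @forEach_cons k body S S₁ S₂ g r t u hk _ _ ih₁ ih₂ =>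
    obtain ⟨v₁, s₁, hs₁, h₁⟩ := ih₁ (fun l => emb (some ⟨g, l⟩)) (emb none)
      (fun l => hM (some ⟨g, l⟩)) (some ⟨k, g⟩)
    obtain ⟨v₂, s₂, hs₂, h₂⟩ := ih₂ emb exit hM v₁
    refine ⟨v₂, s₂ + (s₁ + 1), by omega, ?_⟩
    have h0 := hM none
    rw [iterate_add_apply, iterate_succ_apply]
    have e : flip bind (TM2.step M) (some ⟨some (emb (forEach k body).entry), v, S⟩) =
        some ⟨some (emb (some ⟨g, (body g).entry⟩)), some ⟨k, g⟩, update S k r⟩ := by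
      simp [flip, TM2.step, entry, h0, code, TM2.stepAux, hk, loopTarget]
    rw [e]
    exact (congrArg _ h₁).trans h₂
  | mono _ htu ih =>
    obtain ⟨v', s, hs, h⟩ := ih emb exit hM v
    exact ⟨v', s, hs.trans htu, h⟩

/-- The stack machine that executes `c`, resets its register and halts. -/
noncomputable def machine [Fintype K] [∀ k, Fintype (Γ k)] (k₀ k₁ : K) (c : Cmd Γ) : FinTM2 :=
  haveI := c.finite_lab
  haveI := Fintype.ofFinite (Option c.Lab)
  { K := K
    k₀ := k₀
    k₁ := k₁
    Γ := Γ
    Λ := Option c.Lab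
    main := some c.entry
    σ := Option (Σ k, Γ k)
    initialState := none
    m := fun l => match l with
      | none => .load (fun _ => none) .halt
      | some l => c.code some none l }

/-- The left side is the form, with a cast, in which `initList` and `haltList` give the stacks. -/
theorem dite_eq_update (k₀ : K) (s : List (Γ k₀)) (k : K) :
    (if h : k = k₀ then (by rw [h]; exact s : List (Γ k)) else []) =
      update (fun k => ([] : List (Γ k))) k₀ s k := by
  by_cases hk : k = k₀
  · subst hk; simp
  · simp [hk]

/-- A function is computable in polynomial time if a stack program computes it, starting with all
other stacks empty and leaving all other stacks empty, within polynomially many steps. -/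
theorem computableInPolyTime [Fintype K] [∀ k, Fintype (Γ k)] {α β αΓ βΓ : Type}
    {ea : α → List αΓ} {eb : β → List βΓ} {f : α → β} (k₀ k₁ : K) (c : Cmd Γ)
    (e₀ : Γ k₀ ≃ αΓ) (e₁ : Γ k₁ ≃ βΓ) (time : Polynomial ℕ)
    (h : ∀ a, Runs c (time.eval (ea a).length)
      (update (fun _ => []) k₀ ((ea a).map e₀.symm))
      (update (fun _ => []) k₁ ((eb (f a)).map e₁.symm))) :
    Nonempty (TM2ComputableInPolyTime ea eb f) := by
  refine ⟨⟨⟨machine k₀ k₁ c, e₀, e₁⟩, time + 1, fun a => Nonempty.some ?_⟩⟩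
  obtain ⟨v', s, hs, hrun⟩ := (h a).sound (machine k₀ k₁ c).m some none (fun _ => rfl) none
  -- The extra step executes the statement at the label `none`, which resets the register and halts.
  refine ⟨⟨⟨1 + s, ?_⟩, ?_⟩⟩
  · rw [iterate_add_apply]
    have hi : (some (initList (machine k₀ k₁ c) ((ea a).map e₀.symm)) :
        Option (TM2.Cfg Γ (Option c.Lab) (Option (Σ k, Γ k)))) =
        some ⟨some (some c.entry), none, update (fun _ => []) k₀ ((ea a).map e₀.symm)⟩ := by
      exact congrArg some (congrArg (TM2.Cfg.mk _ _) (funext fun k => dite_eq_update k₀ _ k))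
    have hf : haltList (machine k₀ k₁ c) ((eb (f a)).map e₁.symm) =
        (⟨none, none, update (fun _ => []) k₁ ((eb (f a)).map e₁.symm)⟩ :
        TM2.Cfg Γ (Option c.Lab) (Option (Σ k, Γ k))) := by
      exact congrArg (TM2.Cfg.mk _ _) (funext fun k => dite_eq_update k₁ _ k)
    refine (congrArg _ ((congrArg _ hi).trans hrun)).trans ?_
    exact congrArg some hf.symm
  · simp only [Polynomial.eval_add, Polynomial.eval_one]
    omega

end Cmd

end StackProgram

namespace PartitionedTemplates

open Function

/-! ### Building blocks of transition formulas -/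

namespace Formula

variable {nb nx ny np : ℕ}

/-- Conjunction of a list of formulas and a last formula. -/
def conj (l : List (Formula nb nx ny np)) (G : Formula nb nx ny np) : Formula nb nx ny np :=
  l.foldr and G

theorem sat_conj (l : List (Formula nb nx ny np)) (G : Formula nb nx ny np)
    (s t : State nb nx) (p : Fin np → Bool) (y : Fin ny → ℚ) :
    (conj l G).Sat s t p y ↔ (∀ F ∈ l, F.Sat s t p y) ∧ G.Sat s t p y := by
  induction l with
  | nil => simp [conj]
  | cons F l ih =>
    have : conj (F :: l) G = and F (conj l G) := rfl
    simp [this, Sat, ih, and_assoc]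

theorem guarded_conj {l : List (Formula nb nx ny np)} {G : Formula nb nx ny np}
    (hl : ∀ F ∈ l, F.Guarded) (hG : G.Guarded) : (conj l G).Guarded := by
  induction l with
  | nil => exact hG
  | cons F l ih =>
    exact ⟨hl F (by simp), ih fun F' h => hl F' (by simp [h])⟩

/-- The contradictory linear atom `0 < 0`. -/
def contradiction : Formula nb nx ny np := lin 0 0 0 .lt 0

/-- Selection of one of the formulas `F i`, for `i` in a list, by choice variables. -/
def select (F : Fin np → Formula nb nx ny np) : List (Fin np) → Formula nb nx ny np
  | [] => contradiction
  | i :: l => or (and (lit (.choice i) true) (F i)) (and (lit (.choice i) false) (select F l))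

theorem guarded_select {F : Fin np → Formula nb nx ny np} (hF : ∀ i, (F i).Guarded)
    (l : List (Fin np)) : (select F l).Guarded := by
  induction l with
  | nil => trivial
  | cons i l ih => exact ⟨⟨trivial, hF i⟩, ⟨trivial, ih⟩, .inr ⟨i, F i, select F l, rfl, rfl⟩⟩

/-- The chain of alternatives ends in `0 < 0`, so a satisfying assignment must stop at one of them.
-/
theorem exists_sat_of_sat_select {F : Fin np → Formula nb nx ny np} {l : List (Fin np)}
    {s t : State nb nx} {p : Fin np → Bool} {y : Fin ny → ℚ} (h : (select F l).Sat s t p y) :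
    ∃ i, (F i).Sat s t p y := by
  induction l with
  | nil => simp [select, contradiction, Sat, Cmp.Holds] at h
  | cons i l ih =>
    rcases h with h | h
    · exact ⟨i, h.2⟩
    · exact ih h.2

/-- The one-hot choice at `i` passes over every other alternative and stops at `i`, which occurs in
the list. -/
theorem sat_select {F : Fin np → Formula nb nx ny np} {l : List (Fin np)} {i : Fin np}
    (hi : i ∈ l) {s t : State nb nx} {y : Fin ny → ℚ}
    (h : (F i).Sat s t (fun j => decide (j = i)) y) :
    (select F l).Sat s t (fun j => decide (j = i)) y := by
  induction l with
  | nil => simp at hi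
  | cons j l ih =>
    by_cases hj : j = i
    · subst hj
      exact .inl ⟨by simp [Sat, BoolVar.val], h⟩
    · exact .inr ⟨by simp [Sat, BoolVar.val, hj], ih (by simpa [Ne.symm hj] using hi)⟩

/-- The propositional formula `v`. -/
abbrev isTrue (v : BoolVar nb np) : Formula nb nx ny np := lit v true

/-- The propositional formula `¬ v`. -/
abbrev isFalse (v : BoolVar nb np) : Formula nb nx ny np := lit v false

end Formula

/-! ### The Boolean counter -/

namespace Counter

open Formula

variable {nx ny np K M : ℕ}

/-- A counter bit before the transition. -/
def old (i : Fin (M + 1)) : BoolVar (K + (M + 1)) np := .pre (Fin.natAdd K i)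

/-- A counter bit after the transition. -/
def new (i : Fin (M + 1)) : BoolVar (K + (M + 1)) np := .post (Fin.natAdd K i)

/-- Bit `j` changes if and only if bit `i` changes from `1` to `0`. -/
def gate (i j : Fin (M + 1)) : Formula (K + (M + 1)) nx ny np :=
  or
    (and (and (isTrue (old i)) (isFalse (new i)))
      (or (and (isTrue (old j)) (isFalse (new j))) (and (isFalse (old j)) (isTrue (new j)))))
    (and (or (isFalse (old i)) (isTrue (new i)))
      (or (and (isTrue (old j)) (isTrue (new j))) (and (isFalse (old j)) (isFalse (new j)))))

/-- The lowest bit changes, and all bits up to the given one are updated correctly. -/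
def increment : (j : ℕ) → j < M + 1 → Formula (K + (M + 1)) nx ny np
  | 0, _ => or (and (isTrue (old 0)) (isFalse (new 0))) (and (isFalse (old 0)) (isTrue (new 0)))
  | j + 1, h => and (gate ⟨j, by omega⟩ ⟨j + 1, h⟩) (increment j (by omega))

/-- The highest bit does not change from `1` to `0`. -/
def noOverflow : Formula (K + (M + 1)) nx ny np :=
  or (isFalse (old (Fin.last M))) (isTrue (new (Fin.last M)))

/-- The counter formula. -/
def formula (K M : ℕ) : Formula (K + (M + 1)) nx ny np :=
  and noOverflow (increment M (by omega))

theorem increment_propositional (j : ℕ) (h : j < M + 1) :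
    (increment j h : Formula (K + (M + 1)) nx ny np).IsPropositional ∧
    (increment j h : Formula (K + (M + 1)) nx ny np).Guarded := by
  induction j with
  | zero => simp [increment, IsPropositional, Guarded]
  | succ j ih => simp [increment, IsPropositional, Guarded, gate, ih]

theorem guarded_formula : (formula K M : Formula (K + (M + 1)) nx ny np).Guarded :=
  ⟨by simp [noOverflow, Guarded, IsPropositional], (increment_propositional _ _).2⟩

/-- The counter bits of a Boolean state. -/
def read (b : Fin (K + (M + 1)) → Bool) : Fin (M + 1) → Bool := fun i => b (Fin.natAdd K i)

/-- The binary digits of a number. -/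
def bits (m i : ℕ) : Fin m → Bool := fun j => i.testBit j

theorem bits_injOn {m i i' : ℕ} (hi : i < 2 ^ m) (hi' : i' < 2 ^ m) (h : bits m i = bits m i') :
    i = i' := by
  refine Nat.eq_of_testBit_eq fun j => ?_
  by_cases hj : j < m
  · exact congrFun h ⟨j, hj⟩
  · rw [Nat.testBit_lt_two_pow (hi.trans_le (Nat.pow_le_pow_right two_pos (not_lt.1 hj))),
      Nat.testBit_lt_two_pow (hi'.trans_le (Nat.pow_le_pow_right two_pos (not_lt.1 hj)))]

theorem exists_bits {m : ℕ} (c : Fin m → Bool) : ∃ i < 2 ^ m, c = bits m i :=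
  ⟨Nat.ofBits c, Nat.ofBits_lt_two_pow c, funext fun j => by simp [bits]⟩

theorem testBit_add_one_zero (i : ℕ) : (i + 1).testBit 0 = !i.testBit 0 := by
  simp [Nat.testBit_zero]; grind

/-- Adding one flips a bit exactly if it clears the bit below. -/
theorem testBit_add_one_succ (i j : ℕ) :
    (i + 1).testBit (j + 1) =
      xor (i.testBit (j + 1)) (i.testBit j && !(i + 1).testBit j) := by
  induction j generalizing i with
  | zero =>
    rw [testBit_add_one_zero, Nat.testBit_succ, Nat.testBit_succ]
    rcases Nat.even_or_odd' i with ⟨k, rfl | rfl⟩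
    · rw [show (2 * k + 1) / 2 = k by omega, show 2 * k / 2 = k by omega]
      simp [Nat.testBit_zero]
    · rw [show (2 * k + 1 + 1) / 2 = k + 1 by omega, show (2 * k + 1) / 2 = k by omega]
      simp [Nat.testBit_zero]; grind
  | succ j ih =>
    rw [Nat.testBit_succ (i + 1), Nat.testBit_succ i (j + 1), Nat.testBit_succ i j,
      Nat.testBit_succ (i + 1) j]
    rcases Nat.even_or_odd' i with ⟨k, rfl | rfl⟩
    · rw [show (2 * k + 1) / 2 = k by omega, show 2 * k / 2 = k by omega]
      simp
    · rw [show (2 * k + 1 + 1) / 2 = k + 1 by omega, show (2 * k + 1) / 2 = k by omega]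
      exact ih k

variable {s t : State (K + (M + 1)) nx} {p : Fin np → Bool} {y : Fin ny → ℚ}

theorem sat_gate (i j : Fin (M + 1)) :
    (gate i j).Sat s t p y ↔
      read t.1 j = xor (read s.1 j) (read s.1 i && !read t.1 i) := by
  simp only [gate, Sat, old, new, BoolVar.val, read]
  cases s.1 (Fin.natAdd K i) <;> cases t.1 (Fin.natAdd K i) <;>
    cases s.1 (Fin.natAdd K j) <;> cases t.1 (Fin.natAdd K j) <;> simp

theorem sat_increment {i : ℕ} (hs : read s.1 = bits (M + 1) i) (j : ℕ) (h : j < M + 1) :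
    (increment j h).Sat s t p y ↔ ∀ l (hl : l ≤ j), read t.1 ⟨l, by omega⟩ = (i + 1).testBit l := by
  induction j with
  | zero =>
    have h0 : s.1 (Fin.natAdd K 0) = i.testBit 0 := congrFun hs 0
    have : (∀ l (hl : l ≤ 0), read t.1 ⟨l, by omega⟩ = (i + 1).testBit l) ↔
        t.1 (Fin.natAdd K 0) = !i.testBit 0 := by
      rw [← testBit_add_one_zero]
      exact ⟨fun h => h 0 le_rfl, fun h l hl => by obtain rfl : l = 0 := by omega
                                                   exact h⟩
    rw [this]
    simp only [increment, Sat, old, new, BoolVar.val, h0]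
    cases i.testBit 0 <;> cases t.1 (Fin.natAdd K 0) <;> simp
  | succ j ih =>
    simp only [increment, Sat, sat_gate, ih (by omega)]
    have e1 : read s.1 ⟨j, by omega⟩ = i.testBit j := congrFun hs _
    have e2 : read s.1 ⟨j + 1, by omega⟩ = i.testBit (j + 1) := congrFun hs _
    rw [e1, e2]
    constructor
    · rintro ⟨h1, h2⟩ l hl
      rcases Nat.lt_or_ge j l with hjl | hjl
      · obtain rfl : l = j + 1 := by omega
        rw [h1, h2 j le_rfl, testBit_add_one_succ]
      · exact h2 l hjl
    · intro h'
      exact ⟨by rw [h' (j + 1) le_rfl, h' j (by omega), testBit_add_one_succ],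
        fun l hl => h' l (by omega)⟩

/-- The counter formula describes an increment without overflow. -/
theorem sat_formula {i : ℕ} (hi : i < 2 ^ (M + 1)) (hs : read s.1 = bits (M + 1) i) :
    (formula K M).Sat s t p y ↔ i + 1 < 2 ^ (M + 1) ∧ read t.1 = bits (M + 1) (i + 1) := by
  have key : (increment M (by omega)).Sat s t p y ↔ read t.1 = bits (M + 1) (i + 1) := by
    rw [sat_increment hs]
    exact ⟨fun h => funext fun l => h l (by omega), fun h l hl => congrFun h _⟩
  have hlast : s.1 (Fin.natAdd K (Fin.last M)) = i.testBit M := congrFun hs (Fin.last M)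
  simp only [formula, Sat, key, noOverflow, old, new, BoolVar.val, hlast]
  refine and_congr_left fun ht => ?_
  have hlast' : t.1 (Fin.natAdd K (Fin.last M)) = (i + 1).testBit M := congrFun ht (Fin.last M)
  rw [hlast']
  -- Bit `M + 1` of `i` is zero, so this bit of `i + 1` is just the carry out of bit `M`. Overflow
  -- therefore means that the highest counter bit falls from `1` to `0`.
  have hx := testBit_add_one_succ i M
  rw [Nat.testBit_lt_two_pow hi] at hx
  have : i + 1 < 2 ^ (M + 1) ↔ (i + 1).testBit (M + 1) = false := by
    refine ⟨Nat.testBit_lt_two_pow, fun h => ?_⟩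
    by_contra hc
    have : i + 1 = 2 ^ (M + 1) := by omega
    rw [this, Nat.testBit_two_pow_self] at h
    exact absurd h (by simp)
  rw [this, hx]
  cases i.testBit M <;> cases (i + 1).testBit M <;> simp

end Counter

end PartitionedTemplates

namespace PartitionedTemplates

open Function Turing

/-! ### Binary strings as numbers -/

/-- The number with the given binary digits, least significant first. -/
def natOfBits (l : List Bool) : ℕ := l.foldr Nat.bit 0

theorem natOfBits_append (l l' : List Bool) :
    natOfBits (l ++ l') = natOfBits l + 2 ^ l.length * natOfBits l' := by
  induction l with
  | nil => simp [natOfBits]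
  | cons b l ih =>
    have h (l) : natOfBits (b :: l) = 2 * natOfBits l + b.toNat := by simp [natOfBits, Nat.bit_val]
    rw [List.cons_append, h, h, ih, List.length_cons]
    ring

theorem natOfBits_lt (l : List Bool) : natOfBits l < 2 ^ l.length := by
  induction l with
  | nil => simp [natOfBits]
  | cons b l ih =>
    have h : natOfBits (b :: l) = 2 * natOfBits l + b.toNat := by simp [natOfBits, Nat.bit_val]
    have := b.toNat_le
    rw [h, List.length_cons, pow_succ]
    omega

theorem natOfBits_pos {l : List Bool} : 0 < natOfBits (l ++ [true]) := by
  rw [natOfBits_append]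
  simp [natOfBits]

theorem bits_natOfBits (l : List Bool) : (natOfBits (l ++ [true])).bits = l ++ [true] := by
  induction l with
  | nil => simp [natOfBits]
  | cons b l ih =>
    have h : natOfBits (b :: l ++ [true]) = Nat.bit b (natOfBits (l ++ [true])) := rfl
    have := natOfBits_pos (l := l)
    rw [h, Nat.bits_append_bit _ _ (by omega), ih]
    rfl

theorem natOfBits_replicate_false (k : ℕ) : natOfBits (List.replicate k false) = 0 := by
  induction k with
  | zero => rfl
  | succ k ih =>
    have h : natOfBits (List.replicate (k + 1) false) =
      Nat.bit false (natOfBits (List.replicate k false)) := rfl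
    rw [h, ih]; rfl

theorem natOfBits_two_pow (k : ℕ) : natOfBits (List.replicate k false ++ [true]) = 2 ^ k := by
  rw [natOfBits_append, natOfBits_replicate_false, List.length_replicate]
  simp [natOfBits]

theorem bits_two_pow (k : ℕ) : (2 ^ k).bits = List.replicate k false ++ [true] := by
  rw [← natOfBits_two_pow, bits_natOfBits]

/-! ### Tape contents as rational numbers -/

namespace Decider

variable (D : Decider)

/-- Tape symbols. -/
abbrev Sym : Type := Option (Bool ⊕ D.Aux)

/-- The number of binary digits per tape symbol. -/
noncomputable def width : ℕ := Nat.card D.Aux + 3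

/-- The base of the number representation of tapes. -/
noncomputable def base : ℚ := 2 ^ D.width

/-- Binary digits of the code of an input symbol. The first and the last digit are `1`. -/
noncomputable def symBits (b : Bool) : List Bool :=
  (true :: b :: List.replicate (Nat.card D.Aux) false) ++ [true]

theorem length_symBits (b : Bool) : (D.symBits b).length = D.width := by
  simp [symBits, width]

/-- Codes of tape symbols. Auxiliary symbols have even codes. -/
noncomputable def digit : D.Sym → ℕ
  | none => 0
  | some (.inl b) => natOfBits (D.symBits b)
  | some (.inr a) => 2 * (Finite.equivFin D.Aux a + 1)

theorem natOfBits_symBits (b : Bool) :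
    natOfBits (D.symBits b) = 2 ^ (Nat.card D.Aux + 2) + 2 * b.toNat + 1 := by
  rw [symBits, natOfBits_append]
  have : natOfBits (true :: b :: List.replicate (Nat.card D.Aux) false) =
    Nat.bit true (Nat.bit b (natOfBits (List.replicate (Nat.card D.Aux) false))) := rfl
  rw [this, natOfBits_replicate_false]
  simp [Nat.bit_val, natOfBits]
  ring

theorem digit_lt (a : D.Sym) : D.digit a < 2 ^ D.width := by
  rcases a with _ | b | a
  · simp [digit]
  · rw [← D.length_symBits b]
    exact natOfBits_lt _
  · have h1 := (Finite.equivFin D.Aux a).2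
    have h2 := Nat.lt_two_pow_self (n := Nat.card D.Aux)
    simp only [digit, width, pow_add]
    omega

/-- The blank has code `0`, auxiliary symbols have positive even codes, and input symbols have odd
codes that differ in their second binary digit. -/
theorem digit_injective : Injective D.digit := by
  have hp : 0 < 2 ^ Nat.card D.Aux := by positivity
  rintro (_ | b | a) (_ | b' | a') h <;> simp only [digit, natOfBits_symBits, pow_add] at h
  · rfl
  · omega
  · omega
  · omega
  · cases b <;> cases b' <;> first | rfl | (simp at h)
  · omega
  · omega
  · omega
  · have : Finite.equivFin D.Aux a = Finite.equivFin D.Aux a' := Fin.ext (by omega)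
    rw [(Finite.equivFin D.Aux).injective this]

theorem base_pos : 0 < D.base := by unfold base; positivity

theorem digit_add_one_le (a : D.Sym) : (D.digit a : ℚ) + 1 ≤ D.base := by
  have := D.digit_lt a
  unfold base
  exact_mod_cast this

/-- The number `0.d₁d₂…` for a half tape. -/
noncomputable def fracList (l : List D.Sym) : ℚ := l.foldr (fun a x => (D.digit a + x) / D.base) 0

theorem fracList_replicate (n : ℕ) : D.fracList (List.replicate n default) = 0 := by
  induction n with
  | zero => rfl
  | succ n ih =>
    have : D.fracList (List.replicate (n + 1) default) =
      (D.digit none + D.fracList (List.replicate n default)) / D.base := rfl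
    rw [this, ih]
    simp [digit]

/-- Blanks have code `0` and thus act as trailing zeros. This is what lets the fraction descend to
`ListBlank`, where lists are identified up to trailing blanks. -/
theorem fracList_append_blanks (l : List D.Sym) (n : ℕ) :
    D.fracList (l ++ List.replicate n default) = D.fracList l := by
  have h := D.fracList_replicate n
  rw [fracList] at h
  rw [fracList, List.foldr_append, h, fracList]

/-- The number `0.d₁d₂…` for a half tape. -/
noncomputable def frac (T : ListBlank D.Sym) : ℚ :=
  T.liftOn D.fracList (by rintro a _ ⟨n, rfl⟩; rw [fracList_append_blanks])

theorem frac_mk (l : List D.Sym) : D.frac (ListBlank.mk l) = D.fracList l := rfl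

theorem frac_cons (a : D.Sym) (T : ListBlank D.Sym) :
    D.frac (T.cons a) = (D.digit a + D.frac T) / D.base := by
  induction T using ListBlank.induction_on
  rw [ListBlank.cons_mk]
  rfl

theorem base_mul_frac_cons (a : D.Sym) (T : ListBlank D.Sym) :
    D.base * D.frac (T.cons a) = D.digit a + D.frac T := by
  rw [frac_cons, mul_div_cancel₀ _ D.base_pos.ne']

theorem frac_mem (T : ListBlank D.Sym) : 0 ≤ D.frac T ∧ D.frac T < 1 := by
  induction T using ListBlank.induction_on with
  | _ l =>
    induction l with
    | nil => simp [frac_mk, fracList]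
    | cons a l ih =>
      rw [← ListBlank.cons_mk, frac_cons]
      have := D.digit_add_one_le a
      have := D.base_pos
      exact ⟨div_nonneg (by linarith [ih.1, Nat.cast_nonneg (α := ℚ) (D.digit a)]) this.le,
        (div_lt_one this).2 (by linarith [ih.2])⟩

/-- The head of a half tape with number `x` is `a`. -/
def Reads (a : D.Sym) (x : ℚ) : Prop := D.digit a ≤ D.base * x ∧ D.base * x < D.digit a + 1

/-- The remaining digits form a fraction in `[0, 1)`, so the leading digit is the integer part of
`base * x`. Two linear inequalities thus suffice to test a symbol. -/
theorem reads_cons (a : D.Sym) (T : ListBlank D.Sym) : D.Reads a (D.frac (T.cons a)) := by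
  have := D.frac_mem T
  rw [Reads, base_mul_frac_cons]
  exact ⟨by linarith, by linarith⟩

-- Two unit intervals `[d, d + 1)` with integer ends that share a point are equal.
variable {D} in
theorem Reads.unique {a a' : D.Sym} {x : ℚ} (h : D.Reads a x) (h' : D.Reads a' x) : a = a' := by
  refine D.digit_injective ?_
  have h1 : (D.digit a : ℚ) < D.digit a' + 1 := h.1.trans_lt h'.2
  have h2 : (D.digit a' : ℚ) < D.digit a + 1 := h'.1.trans_lt h.2
  norm_cast at h1 h2
  omega

/-! ### The number of the input word -/

/-- Binary digits of the numerator of the initial tape. -/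
noncomputable def wordBits (w : List Bool) : List Bool := w.reverse.flatMap D.symBits

theorem length_wordBits (w : List Bool) : (D.wordBits w).length = D.width * w.length := by
  simp [wordBits, List.length_flatMap, length_symBits, mul_comm]

theorem wordBits_cons (b : Bool) (w : List Bool) :
    D.wordBits (b :: w) = D.wordBits w ++ D.symBits b := by
  simp [wordBits]

theorem fracList_word (w : List Bool) :
    D.fracList (w.map fun b => some (.inl b)) =
      (natOfBits (D.wordBits w) : ℚ) / (2 ^ (D.width * w.length) : ℕ) := by
  induction w with
  | nil => simp [fracList, wordBits, natOfBits]
  | cons b w ih =>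
    have : D.fracList ((b :: w).map fun b => some (.inl b)) =
      (natOfBits (D.symBits b) + D.fracList (w.map fun b => some (.inl b))) / D.base := rfl
    rw [this, ih, wordBits_cons, natOfBits_append, length_wordBits, base, List.length_cons]
    push_cast
    rw [mul_add, pow_add, mul_one]
    field_simp
    ring

/-- The most significant block comes from the first letter, and the last digit of each block is `1`.
So there are no leading zeros for `Nat.bits` to drop. -/
theorem bits_wordBits (w : List Bool) : (natOfBits (D.wordBits w)).bits = D.wordBits w := by
  cases w with
  | nil => simp [wordBits, natOfBits]
  | cons b w =>
    rw [wordBits_cons, symBits, ← List.append_assoc, bits_natOfBits]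

/-- The least significant block comes from the last letter, and the first digit of each block is
`1`, so the numerator is odd. Hence the numerator and denominator that are stored for the fraction
are the ones displayed in `fracList_word`. -/
theorem coprime_word (w : List Bool) :
    Nat.Coprime (natOfBits (D.wordBits w)) (2 ^ (D.width * w.length)) := by
  rcases List.eq_nil_or_concat w with rfl | ⟨w, b, rfl⟩
  · simp
  · refine Nat.Coprime.pow_right _ (Nat.coprime_two_right.2 ?_)
    have : D.wordBits (w ++ [b]) = D.symBits b ++ D.wordBits w := by simp [wordBits]
    rw [List.concat_eq_append, this, natOfBits_append, natOfBits_symBits, length_symBits]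
    have h1 : Even (2 ^ (Nat.card D.Aux + 2)) := by simp [Nat.even_pow]
    have h2 : Even (2 ^ D.width) := by simp [Nat.even_pow, width]
    exact ((h1.add (even_two_mul _)).add_one).add_even (h2.mul_right _)

theorem num_word (w : List Bool) :
    (D.fracList (w.map fun b => some (.inl b))).num = natOfBits (D.wordBits w) := by
  rw [fracList_word]
  have := Rat.num_div_eq_of_coprime (a := natOfBits (D.wordBits w))
    (b := (2 ^ (D.width * w.length) : ℕ)) (by positivity) (D.coprime_word w)
  simpa only [Int.cast_natCast] using this

theorem den_word (w : List Bool) :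
    (D.fracList (w.map fun b => some (.inl b))).den = 2 ^ (D.width * w.length) := by
  rw [fracList_word]
  have := Rat.den_div_eq_of_coprime (a := natOfBits (D.wordBits w))
    (b := (2 ^ (D.width * w.length) : ℕ)) (by positivity) (D.coprime_word w)
  simp only [Int.cast_natCast] at this
  exact Nat.cast_injective this

end Decider

end PartitionedTemplates

namespace PartitionedTemplates

open Function Turing

namespace Decider

/-! ### The program that simulates a machine -/

open Formula Counter

variable (D : Decider)

/-- Control states of the simulation: the states of the machine and, as `none`, a state that is
entered when the machine rejects. -/
abbrev Control : Type := Option D.Q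

/-- A control state, the symbol under the head, and the symbol to its left. -/
abbrev Case : Type := D.Control × D.Sym × D.Sym

/-- The number of control bits. -/
noncomputable abbrev controlCard : ℕ := Nat.card D.Control

/-- The number of cases. -/
noncomputable abbrev caseCard : ℕ := Nat.card D.Case

/-- Codes of control states. -/
noncomputable def controlBits (q : D.Control) : Fin D.controlCard → Bool :=
  fun i => decide (i = Finite.equivFin D.Control q)

theorem controlBits_injective : Injective D.controlBits := by
  intro q q' h
  have := congrFun h (Finite.equivFin D.Control q)
  simpa [controlBits] using this

/-- A new control state and a coordinatewise affine update `xⱼ ↦ scale j * xⱼ + offset j`. -/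
structure Rule where
  target : D.Control
  scale : Fin 2 → ℚ
  offset : Fin 2 → ℚ

open Classical in
/-- The transition of the simulation in a given case. The left half of the tape is in coordinate
`0`, the right half with the symbol under the head is in coordinate `1`. -/
noncomputable def rule : D.Case → Option D.Rule
  -- After rejection the program idles and only the counter advances.
  | (none, _, _) => some ⟨none, 1, 0⟩
  | (some q, a, b) =>
    match D.M q a with
    -- Acceptance blocks the program. Rejection clears both numbers, so that the bad state does not
    -- depend on the final tape.
    | none => if q ∈ D.accept then none else some ⟨none, 0, 0⟩
    -- The scanned digit is pushed on the left half and popped from the right half.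
    | some (q', .move .right) =>
        some ⟨some q', ![1 / D.base, D.base], ![D.digit a / D.base, -D.digit a]⟩
    -- The digit popped from the left half is that of `b`; this is why a case records the left
    -- neighbour of the head.
    | some (q', .move .left) =>
        some ⟨some q', ![D.base, 1 / D.base], ![-D.digit b, D.digit b / D.base]⟩
    -- The leading digit of the right half is exchanged.
    | some (q', .write c) => some ⟨some q', 1, ![0, (D.digit c - D.digit a) / D.base]⟩

/-- The numeric update of a rule. -/
def Rule.affine {D : Decider} (u : D.Rule) : (Fin 2 → ℚ) →ᵃ[ℚ] (Fin 2 → ℚ) where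
  toFun x j := u.scale j * x j + u.offset j
  linear := LinearMap.pi fun j => u.scale j • LinearMap.proj j
  map_vadd' x v := by ext j; simp; ring

variable (M : ℕ)

/-- The atoms that say that `a` is the head of the half tape in coordinate `j`. -/
noncomputable def readFormulas {nb np : ℕ} (j : Fin 2) (a : D.Sym) : List (Formula nb 2 0 np) :=
  [lin (Pi.single j (-D.base)) 0 0 .le (-D.digit a), lin (Pi.single j D.base) 0 0 .lt (D.digit a + 1)]

/-- The assignment to coordinate `j`. -/
def Rule.assign {D : Decider} {nb np : ℕ} (u : D.Rule) (j : Fin 2) : Formula nb 2 0 np :=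
  lin (Pi.single j (-u.scale j)) (Pi.single j 1) 0 .eq (u.offset j)

/-- The literals for a control state before the transition. -/
noncomputable def controlBefore {np : ℕ} (q : D.Control) :
    List (Formula (D.controlCard + (M + 1)) 2 0 np) :=
  (List.finRange D.controlCard).map fun i => lit (.pre (Fin.castAdd (M + 1) i)) (D.controlBits q i)

/-- The literals for a control state after the transition. -/
noncomputable def controlAfter {np : ℕ} (q : D.Control) :
    List (Formula (D.controlCard + (M + 1)) 2 0 np) :=
  (List.finRange D.controlCard).map fun i => lit (.post (Fin.castAdd (M + 1) i)) (D.controlBits q i)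

/-- The transition formula for one case. -/
noncomputable def caseFormula (c : D.Case) : Formula (D.controlCard + (M + 1)) 2 0 D.caseCard :=
  match D.rule c with
  | none => contradiction
  | some u => conj (D.controlBefore M c.1 ++ D.controlAfter M u.target ++
      D.readFormulas 1 c.2.1 ++ D.readFormulas 0 c.2.2 ++ [u.assign 0]) (u.assign 1)

/-- The transition formula for the control state and the numeric variables. -/
noncomputable def controlFormula : Formula (D.controlCard + (M + 1)) 2 0 D.caseCard :=
  select (fun i => D.caseFormula M ((Finite.equivFin D.Case).symm i)) (List.finRange D.caseCard)

/-- Boolean states. -/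
noncomputable def boolState (q : D.Control) (i : ℕ) : Fin (D.controlCard + (M + 1)) → Bool :=
  Fin.append (D.controlBits q) (bits (M + 1) i)

/-- The program. -/
noncomputable def program (w : List Bool) : Program where
  nb := D.controlCard + (M + 1)
  nx := 2
  ny := 0
  np := D.caseCard
  T := and (D.controlFormula M) (Counter.formula D.controlCard M)
  b₀ := D.boolState M (some default) 0
  x₀ := ![0, D.fracList (w.map fun b => some (.inl b))]

/-- The instance: the bad state is the rejecting state with the largest counter value. -/
noncomputable def inst (w : List Bool) : AnalysisInstance where
  prog := D.program M w
  nrow := 4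
  A := (![Pi.single 0 1, Pi.single 0 (-1), Pi.single 1 1, Pi.single 1 (-1)] :
    Fin 4 → Fin 2 → ℚ)
  bad := (D.boolState M none (2 ^ (M + 1) - 1), (0 : Fin 2 → ℚ))

/-- The control bits of a Boolean state. -/
def control {K M : ℕ} (b : Fin (K + (M + 1)) → Bool) : Fin K → Bool :=
  fun i => b (Fin.castAdd (M + 1) i)

variable {M}

theorem control_boolState (q : D.Control) (i : ℕ) :
    control (D.boolState M q i) = D.controlBits q := by
  ext; simp [control, boolState]

theorem read_boolState (q : D.Control) (i : ℕ) :
    read (D.boolState M q i) = bits (M + 1) i := by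
  ext; simp [Counter.read, boolState]

theorem eq_boolState {b : Fin (D.controlCard + (M + 1)) → Bool} {q : D.Control} {i : ℕ}
    (h : control b = D.controlBits q) (h' : read b = bits (M + 1) i) : b = D.boolState M q i := by
  funext j
  refine Fin.addCases (fun j => ?_) (fun j => ?_) j
  · rw [boolState, Fin.append_left]; exact congrFun h j
  · rw [boolState, Fin.append_right]; exact congrFun h' j

section Sat

variable {s t : State (D.controlCard + (M + 1)) 2} {p : Fin D.caseCard → Bool} {y : Fin 0 → ℚ}

theorem sat_caseFormula (c : D.Case) :
    (D.caseFormula M c).Sat s t p y ↔ ∃ u, D.rule c = some u ∧ control s.1 = D.controlBits c.1 ∧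
      control t.1 = D.controlBits u.target ∧ D.Reads c.2.1 (s.2 1) ∧ D.Reads c.2.2 (s.2 0) ∧
      t.2 = u.affine s.2 := by
  unfold caseFormula
  cases D.rule c with
  | none => simp [contradiction, Sat, Cmp.Holds]
  | some u =>
    have hread (j : Fin 2) (a : D.Sym) :
        (∀ F ∈ D.readFormulas j a, F.Sat s t p y) ↔ D.Reads a (s.2 j) := by
      simp [readFormulas, Sat, Cmp.Holds, Reads, Pi.single_apply]
    have hassign (j : Fin 2) : (u.assign j).Sat s t p y ↔ t.2 j = u.affine s.2 j := by
      simp only [Rule.assign, Sat, Cmp.Holds, Rule.affine, Pi.single_apply, ite_mul, zero_mul,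
        Finset.sum_ite_eq', Finset.mem_univ, if_true, Pi.zero_apply, one_mul, AffineMap.coe_mk]
      constructor <;> intro h <;> simp at h ⊢ <;> linarith
    have hpre : (∀ F ∈ D.controlBefore M c.1, F.Sat s t p y) ↔
        control s.1 = D.controlBits c.1 := by
      simp [controlBefore, Sat, BoolVar.val, funext_iff, control]
    have hpost : (∀ F ∈ D.controlAfter M u.target, F.Sat s t p y) ↔
        control t.1 = D.controlBits u.target := by
      simp [controlAfter, Sat, BoolVar.val, funext_iff, control]
    have hvec : t.2 = u.affine s.2 ↔ t.2 0 = u.affine s.2 0 ∧ t.2 1 = u.affine s.2 1 := by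
      rw [funext_iff, Fin.forall_fin_two]
    rw [sat_conj]
    simp only [List.mem_append, or_imp, forall_and, hread, hpre, hpost, List.mem_singleton,
      forall_eq, hassign, hvec, Option.some.injEq, exists_eq_left']
    tauto

theorem guarded_caseFormula (c : D.Case) : (D.caseFormula M c).Guarded := by
  unfold caseFormula
  split
  · trivial
  · refine guarded_conj (fun F hF => ?_) trivial
    simp only [List.mem_append, controlBefore, controlAfter, readFormulas, List.mem_map,
      List.mem_cons, List.not_mem_nil, or_false] at hF
    rcases hF with (((⟨_, _, rfl⟩ | ⟨_, _, rfl⟩) | rfl | rfl) | rfl | rfl) | rfl <;> trivial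

end Sat

variable {w : List Bool} {s t t' : State (D.controlCard + (M + 1)) 2}

/-- The transitions of the program. -/
theorem step_iff {i : ℕ} (hi : i < 2 ^ (M + 1)) (hs : read s.1 = bits (M + 1) i) :
    (D.program M w).Step s t ↔ i + 1 < 2 ^ (M + 1) ∧ read t.1 = bits (M + 1) (i + 1) ∧
      ∃ c u, D.rule c = some u ∧ control s.1 = D.controlBits c.1 ∧
        control t.1 = D.controlBits u.target ∧ D.Reads c.2.1 (s.2 1) ∧ D.Reads c.2.2 (s.2 0) ∧
        t.2 = u.affine s.2 := by
  constructor
  · rintro ⟨y, p, h1, h2⟩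
    obtain ⟨h3, h4⟩ := (sat_formula hi hs).1 h2
    obtain ⟨j, hj⟩ := exists_sat_of_sat_select h1
    exact ⟨h3, h4, _, (D.sat_caseFormula _).1 hj⟩
  · rintro ⟨h1, h2, c, h3⟩
    -- The path choice is one-hot at the index of the case; there are no variables `y`, so `0` is
    -- the only candidate.
    refine ⟨0, fun j : Fin D.caseCard => decide (j = Finite.equivFin D.Case c), ?_,
      (sat_formula hi hs).2 ⟨h1, h2⟩⟩
    refine sat_select (F := fun i => D.caseFormula M ((Finite.equivFin D.Case).symm i))
      (List.mem_finRange _) ((D.sat_caseFormula _).2 ?_)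
    rwa [Equiv.symm_apply_apply]

/-- The departure state determines the case, since control codes are injective and a fraction has
only one leading digit. The case determines the new control state and the numeric update, and the
counter part has only one successor. -/
theorem deterministic : (D.program M w).Deterministic := by
  intro s t t' h h'
  obtain ⟨i, hi, hs⟩ := exists_bits (read s.1)
  obtain ⟨-, h1, c, u, h2, h3, h4, h5, h6, h7⟩ := (D.step_iff hi hs).1 h
  obtain ⟨-, h1', c', u', h2', h3', h4', h5', h6', h7'⟩ := (D.step_iff hi hs).1 h'
  have hc : c = c' := Prod.ext (D.controlBits_injective (h3.symm.trans h3'))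
    (Prod.ext (h5.unique h5') (h6.unique h6'))
  subst hc
  obtain rfl : u = u' := Option.some.inj (h2.symm.trans h2')
  exact Prod.ext ((D.eq_boolState h4 h1).trans (D.eq_boolState h4' h1').symm) (h7.trans h7'.symm)

theorem guarded : (D.program M w).T.Guarded :=
  ⟨guarded_select (fun _ => D.guarded_caseFormula _) _, guarded_formula⟩

theorem hasAffineUpdates : (D.program M w).HasAffineUpdates D.caseCard := by
  classical
  refine ⟨Finset.univ.image fun i : Fin D.caseCard =>
    ((D.rule ((Finite.equivFin D.Case).symm i)).map Rule.affine).getD (AffineMap.id ℚ _),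
    Finset.card_image_le.trans (by simp), fun s t h => ?_⟩
  obtain ⟨i, hi, hs⟩ := exists_bits (read s.1)
  obtain ⟨-, -, c, u, h2, -, -, -, -, h7⟩ := (D.step_iff hi hs).1 h
  refine ⟨u.affine, Finset.mem_image.2 ⟨Finite.equivFin D.Case c, Finset.mem_univ _, ?_⟩, h7⟩
  rw [Equiv.symm_apply_apply, h2]
  rfl

/-! ### The counter separates reachable states -/

/-- Reachable states with counter value `i` are reached after exactly `i` transitions. -/
theorem reachable_unique (i : ℕ) : ∀ s ∈ (D.program M w).reachable,
    ∀ t ∈ (D.program M w).reachable, i < 2 ^ (M + 1) → read s.1 = bits (M + 1) i →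
    read t.1 = bits (M + 1) i → s = t := by
  have hinit : read (D.program M w).init.1 = bits (M + 1) 0 := D.read_boolState _ _
  have hcases : ∀ s ∈ (D.program M w).reachable, s = (D.program M w).init ∨
      ∃ r ∈ (D.program M w).reachable, (D.program M w).Step r s := by
    intro s hs
    rcases Relation.ReflTransGen.cases_tail hs with h | ⟨r, hr, h⟩
    · exact .inl h
    · exact .inr ⟨r, hr, h⟩
  -- A transition never wraps the counter around, so value `0` has no predecessor and a predecessor
  -- of a state with value `i` has value `i - 1`. Determinism then propagates uniqueness from the
  -- initial state.
  have hpred : ∀ (r s : State (D.controlCard + (M + 1)) 2) (i : ℕ), (D.program M w).Step r s →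
      i < 2 ^ (M + 1) → read s.1 = bits (M + 1) i → ∃ j, i = j + 1 ∧ j < 2 ^ (M + 1) ∧
      read r.1 = bits (M + 1) j := by
    intro r s i h hi hs
    obtain ⟨j, hj, hr⟩ := exists_bits (read r.1)
    obtain ⟨h1, h2, -⟩ := (D.step_iff hj hr).1 h
    exact ⟨j, bits_injOn hi h1 (hs.symm.trans h2), hj, hr⟩
  induction i with
  | zero =>
    intro s hs t ht hi hrs hrt
    rcases hcases s hs with rfl | ⟨r, -, h⟩
    · rcases hcases t ht with rfl | ⟨r, -, h⟩
      · rfl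
      · obtain ⟨j, hj, -⟩ := hpred _ _ _ h hi hrt
        omega
    · obtain ⟨j, hj, -⟩ := hpred _ _ _ h hi hrs
      omega
  | succ i ih =>
    intro s hs t ht hi hrs hrt
    have hne : ¬ read (D.program M w).init.1 = bits (M + 1) (i + 1) := fun h => by
      have := bits_injOn (by positivity) hi (hinit.symm.trans h)
      omega
    rcases hcases s hs with rfl | ⟨r, hr, h⟩
    · exact absurd hrs hne
    · rcases hcases t ht with rfl | ⟨r', hr', h'⟩
      · exact absurd hrt hne
      · obtain ⟨j, hj, hjlt, hjr⟩ := hpred _ _ _ h hi hrs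
        obtain ⟨j', hj', -, hjr'⟩ := hpred _ _ _ h' hi hrt
        obtain rfl : i = j := by omega
        obtain rfl : i = j' := by omega
        obtain rfl := ih r hr r' hr' hjlt hjr hjr'
        exact D.deterministic _ _ _ h h'

theorem reachable_ext {s t : State (D.controlCard + (M + 1)) 2}
    (hs : s ∈ (D.program M w).reachable) (ht : t ∈ (D.program M w).reachable)
    (h : read s.1 = read t.1) : s = t := by
  obtain ⟨i, hi, hsi⟩ := exists_bits (read s.1)
  exact D.reachable_unique i s hs t ht hi hsi (h.symm.trans hsi)

theorem hasSeparatingCounter : (D.program M w).HasSeparatingCounter (M + 1) := by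
  have hcard : ((Finset.univ : Finset (Fin (M + 1))).map (Fin.natAddEmb D.controlCard)).card ≤
      M + 1 := by simp
  exact ⟨_, hcard, fun s hs t ht h => D.reachable_ext hs ht (funext fun i =>
    h _ (Finset.mem_map_of_mem _ (Finset.mem_univ i)))⟩

end Decider

end PartitionedTemplates

namespace PartitionedTemplates

open Function Turing

namespace Decider

open Formula Counter

variable (D : Decider) (M : ℕ)

/-! ### Simulation of the machine -/

/-- Configurations of the machine. -/
abbrev Config : Type := TM0.Cfg D.Sym D.Q

/-- The state of the program for a configuration after `i` steps. -/
noncomputable def conf (i : ℕ) (c : D.Config) : State (D.controlCard + (M + 1)) 2 :=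
  (D.boolState M (some c.q) i, ![D.frac c.Tape.left, D.frac (c.Tape.right.cons c.Tape.head)])

/-- The rejecting state with counter value `i`. -/
noncomputable def reject (i : ℕ) : State (D.controlCard + (M + 1)) 2 := (D.boolState M none i, 0)

variable {M} {w : List Bool} {i : ℕ} {c c' : D.Config}

theorem frac_head_tail (T : ListBlank D.Sym) :
    D.base * D.frac T = D.digit T.head + D.frac T.tail := by
  conv_lhs => rw [← ListBlank.cons_head_tail T]
  rw [base_mul_frac_cons]

theorem reads_head (T : ListBlank D.Sym) : D.Reads T.head (D.frac T) := by
  conv_rhs => rw [← ListBlank.cons_head_tail T]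
  exact D.reads_cons _ _

theorem reads_zero : D.Reads none 0 := by simp [Reads, digit]

theorem init_eq_conf : (D.program M w).init = D.conf M 0 (D.start w) := by
  refine Prod.ext rfl ?_
  change (![0, _] : Fin 2 → ℚ) = ![_, _]
  have h1 : D.frac (D.start w).Tape.left = 0 := rfl
  have h2 : (D.start w).Tape.right.cons (D.start w).Tape.head =
      ListBlank.mk (w.map fun b => some (.inl b)) :=
    ListBlank.cons_head_tail (ListBlank.mk (w.map fun b => some (.inl b) : List D.Sym))
  rw [h1, h2, frac_mk]

/-- The guards hold automatically in the encoding of a configuration. What remains of the simulation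
of a step are the two scalar equations `h₀` and `h₁`. -/
theorem step_conf_of_rule {u : D.Rule} {x : Fin 2 → ℚ} (hi : i + 1 < 2 ^ (M + 1))
    (h : D.rule (some c.q, c.Tape.head, c.Tape.left.head) = some u)
    (h₀ : x 0 = u.scale 0 * D.frac c.Tape.left + u.offset 0)
    (h₁ : x 1 = u.scale 1 * D.frac (c.Tape.right.cons c.Tape.head) + u.offset 1) :
    (D.program M w).Step (D.conf M i c) (D.boolState M u.target (i + 1), x) := by
  refine (D.step_iff (by omega) (D.read_boolState _ _)).2 ⟨hi, D.read_boolState _ _,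
    _, u, h, D.control_boolState _ _, D.control_boolState _ _, ?_, ?_, ?_⟩
  · exact D.reads_cons _ _
  · exact D.reads_head _
  · exact funext (Fin.forall_fin_two.2 ⟨h₀, h₁⟩)

/-- Multiplication by `base` splits a fraction into the digit of its head and the fraction of its
tail. With this identity each of the three kinds of machine step becomes the affine update of its
rule. -/
theorem step_conf (hi : i + 1 < 2 ^ (M + 1)) (h : TM0.step D.M c = some c') :
    (D.program M w).Step (D.conf M i c) (D.conf M (i + 1) c') := by
  obtain ⟨q, a, L, R⟩ := c
  have hB := D.base_pos.ne'
  have hR := D.base_mul_frac_cons a R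
  have hL := D.frac_head_tail L
  simp only [TM0.step, Option.map_eq_some_iff] at h
  obtain ⟨⟨q', st⟩, hM, rfl⟩ := h
  rcases st with (_ | _) | b
  · have hu : D.rule (some q, a, L.head) =
        some ⟨some q', ![D.base, 1 / D.base], ![-D.digit L.head, D.digit L.head / D.base]⟩ := by
      simp [rule, hM]
    refine D.step_conf_of_rule (c := ⟨q, a, L, R⟩) hi hu ?_ ?_
    · change D.frac L.tail = D.base * D.frac L + -D.digit L.head
      linarith
    · change D.frac ((R.cons a).cons L.head) =
        1 / D.base * D.frac (R.cons a) + D.digit L.head / D.base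
      rw [D.frac_cons L.head]
      ring
  · have hu : D.rule (some q, a, L.head) =
        some ⟨some q', ![1 / D.base, D.base], ![D.digit a / D.base, -D.digit a]⟩ := by
      simp [rule, hM]
    refine D.step_conf_of_rule (c := ⟨q, a, L, R⟩) hi hu ?_ ?_
    · change D.frac (L.cons a) = 1 / D.base * D.frac L + D.digit a / D.base
      rw [frac_cons]
      ring
    · change D.frac (R.tail.cons R.head) = D.base * D.frac (R.cons a) + -D.digit a
      rw [ListBlank.cons_head_tail]
      linarith
  · have hu : D.rule (some q, a, L.head) =
        some ⟨some q', 1, ![0, (D.digit b - D.digit a) / D.base]⟩ := by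
      simp [rule, hM]
    refine D.step_conf_of_rule (c := ⟨q, a, L, R⟩) hi hu ?_ ?_
    · change D.frac L = 1 * D.frac L + 0
      ring
    · change D.frac (R.cons b) = 1 * D.frac (R.cons a) + (D.digit b - D.digit a) / D.base
      rw [frac_cons, frac_cons]
      ring

theorem step_conf_reject (hi : i + 1 < 2 ^ (M + 1)) (h : TM0.step D.M c = none)
    (hc : c.q ∉ D.accept) : (D.program M w).Step (D.conf M i c) (D.reject M (i + 1)) := by
  have hM : D.M c.q c.Tape.head = none := by simpa [TM0.step] using h
  have hu : D.rule (some c.q, c.Tape.head, c.Tape.left.head) = some ⟨none, 0, 0⟩ := by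
    simp [rule, hM, hc]
  exact D.step_conf_of_rule hi hu (by simp) (by simp)

/-- The control bits and the leading digit fix the case up to the left neighbour, and no choice of
the neighbour gives a rule. -/
theorem not_step_conf_accept {t} (hi : i < 2 ^ (M + 1)) (h : TM0.step D.M c = none)
    (hc : c.q ∈ D.accept) : ¬ (D.program M w).Step (D.conf M i c) t := by
  intro hst
  obtain ⟨-, -, ⟨q, a, b⟩, u, h1, h2, -, h3, -⟩ := (D.step_iff hi (D.read_boolState _ _)).1 hst
  have hM : D.M c.q c.Tape.head = none := by simpa [TM0.step] using h
  obtain rfl : some c.q = q := D.controlBits_injective ((D.control_boolState _ _).symm.trans h2)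
  obtain rfl : a = c.Tape.head := h3.unique (D.reads_cons _ _)
  simp [rule, hM, hc] at h1

theorem step_reject (hi : i + 1 < 2 ^ (M + 1)) :
    (D.program M w).Step (D.reject M i) (D.reject M (i + 1)) := by
  refine (D.step_iff (by omega) (D.read_boolState _ _)).2 ⟨hi, D.read_boolState _ _,
    (none, none, none), ⟨none, 1, 0⟩, rfl, D.control_boolState _ _, D.control_boolState _ _,
    D.reads_zero, D.reads_zero, ?_⟩
  ext j
  simp [Rule.affine, reject]

/-- The configuration after `i` steps, if the machine has not halted before. -/
def after (w : List Bool) (i : ℕ) : Option D.Config :=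
  (flip bind (TM0.step D.M))^[i] (some (D.start w))

theorem after_succ (i : ℕ) : D.after w (i + 1) = (D.after w i).bind (TM0.step D.M) := by
  rw [after, iterate_succ_apply']
  rfl

theorem after_none {i j : ℕ} (h : D.after w i = none) (hij : i ≤ j) : D.after w j = none := by
  induction j, hij using Nat.le_induction with
  | base => exact h
  | succ j _ ih => rw [after_succ, ih]; rfl

theorem conf_reachable (hi : i < 2 ^ (M + 1)) (h : D.after w i = some c) :
    D.conf M i c ∈ (D.program M w).reachable := by
  induction i generalizing c with
  | zero =>
    obtain rfl : D.start w = c := Option.some.inj h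
    rw [← init_eq_conf]
    exact .refl
  | succ i ih =>
    rw [after_succ, Option.bind_eq_some_iff] at h
    obtain ⟨c', h1, h2⟩ := h
    exact .tail (ih (by omega) h1) (D.step_conf hi h2)

variable {T : ℕ}

theorem reject_reachable (hT : D.after w T = some c) (hc : TM0.step D.M c = none)
    (ha : c.q ∉ D.accept) (hi : T < i) (hi' : i < 2 ^ (M + 1)) :
    D.reject M i ∈ (D.program M w).reachable := by
  induction i, hi using Nat.le_induction with
  | base => exact .tail (D.conf_reachable (by omega) hT) (D.step_conf_reject hi' hc ha)
  | succ i _ ih => exact .tail (ih (by omega)) (D.step_reject hi')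

/-- By determinism the program follows the encoded run as long as the machine runs, and the final
accepting configuration has no successor. In particular the control state `none` is never entered.
-/
theorem reachable_of_accept (hT : D.after w T = some c) (hc : TM0.step D.M c = none)
    (ha : c.q ∈ D.accept) {s : State (D.controlCard + (M + 1)) 2}
    (hs : s ∈ (D.program M w).reachable) :
    ∃ i < 2 ^ (M + 1), ∃ c', D.after w i = some c' ∧ s = D.conf M i c' := by
  refine Relation.ReflTransGen.rec
    (motive := fun s _ => ∃ i < 2 ^ (M + 1), ∃ c', D.after w i = some c' ∧ s = D.conf M i c')
    ⟨0, by positivity, _, rfl, D.init_eq_conf⟩ ?_ hs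
  rintro _ t - hst ⟨i, hi, c', hc', rfl⟩
  have hi1 := ((D.step_iff hi (D.read_boolState _ _)).1 hst).1
  cases h : TM0.step D.M c' with
  | some c'' =>
    exact ⟨i + 1, hi1, c'', by rw [after_succ, hc']; exact h,
      D.deterministic _ _ _ hst (D.step_conf hi1 h)⟩
  | none =>
    have hn : D.after w (i + 1) = none := by rw [after_succ, hc']; exact h
    have hn' : D.after w (T + 1) = none := by rw [after_succ, hT]; exact hc
    -- Both `i` and `T` are the last index at which `after` is defined, hence they agree.
    have h1 : ¬ i + 1 ≤ T := fun h => by simpa [hT] using D.after_none hn h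
    have h2 : ¬ T + 1 ≤ i := fun h => by simpa [hc'] using D.after_none hn' h
    obtain rfl : i = T := by omega
    obtain rfl : c' = c := Option.some.inj (hc'.symm.trans hT)
    exact absurd hst (D.not_step_conf_accept hi h ha)

/-- The bad state is reachable exactly if the machine rejects. -/
theorem bad_mem_reachable_iff (hT : D.after w T = some c) (hc : TM0.step D.M c = none)
    (hlt : T + 1 < 2 ^ (M + 1)) :
    (D.inst M w).bad ∈ (D.program M w).reachable ↔ c.q ∉ D.accept := by
  constructor
  · intro h ha
    obtain ⟨i, -, c', -, h⟩ := D.reachable_of_accept hT hc ha h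
    have h1 : D.boolState M none (2 ^ (M + 1) - 1) = D.boolState M (some c'.q) i :=
      congrArg Prod.fst h
    have h2 := congrArg control h1
    rw [control_boolState, control_boolState] at h2
    exact Option.some_ne_none _ (D.controlBits_injective h2).symm
  · intro ha
    -- The rejecting state is first entered with counter value `T + 1`, which by `hlt` is at most
    -- the largest value; idling covers the rest.
    exact D.reject_reachable hT hc ha (by omega) (by omega)

/-! ### The least inductive invariant -/

theorem isIntervalTemplate : IsIntervalTemplate (D.inst M w).A := by
  constructor
  · intro i
    change Fin 4 at i
    fin_cases i
    · exact ⟨(0 : Fin 2), .inl rfl⟩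
    · exact ⟨(0 : Fin 2), .inr rfl⟩
    · exact ⟨(1 : Fin 2), .inl rfl⟩
    · exact ⟨(1 : Fin 2), .inr rfl⟩
  · intro j
    change Fin 2 at j
    fin_cases j
    · exact ⟨⟨(0 : Fin 4), rfl⟩, (1 : Fin 4), rfl⟩
    · exact ⟨⟨(2 : Fin 4), rfl⟩, (3 : Fin 4), rfl⟩

end Decider

theorem ofRat_le_ofRat {x y : ℚ} : ExtRat.ofRat x ≤ ExtRat.ofRat y ↔ x ≤ y := by
  simp [ExtRat.ofRat]

/-- If for every Boolean state at most one numeric state is reachable, then the set of reachable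
states is described by the least inductive invariant in the interval domain. -/
theorem exists_exact_leastInvariant (I : AnalysisInstance) (hA : IsIntervalTemplate I.A)
    (hrow : 0 < I.nrow)
    (h : ∀ s ∈ I.prog.reachable, ∀ t ∈ I.prog.reachable, s.1 = t.1 → s = t) :
    ∃ ρ, I.IsLeastInvariant ρ ∧ concretization I.A ρ = I.prog.reachable := by
  classical
  -- The bounds are those of the unique reachable point over `b`, and `-∞` if there is none.
  let ρ : AbstractValue I.prog.nb I.nrow := fun b i =>
    if hb : ∃ x, (b, x) ∈ I.prog.reachable then ExtRat.ofRat (I.A.mulVec hb.choose i) else ⊥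
  have hρ (b x i) (hx : (b, x) ∈ I.prog.reachable) : ρ b i = ExtRat.ofRat (I.A.mulVec x i) := by
    have hb : ∃ x, (b, x) ∈ I.prog.reachable := ⟨x, hx⟩
    have : hb.choose = x := congrArg Prod.snd (h _ hb.choose_spec _ hx rfl)
    simp only [ρ, dif_pos hb, this]
  have hex : concretization I.A ρ = I.prog.reachable := by
    ext ⟨b, x⟩
    constructor
    · intro hx
      have hb : ∃ x, (b, x) ∈ I.prog.reachable := by
        by_contra hb
        -- One row suffices for the bound `-∞` to exclude `x`; without rows everything would be
        -- included.
        have := hx ⟨0, hrow⟩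
        simp [ρ, dif_neg hb, ExtRat.ofRat] at this
      obtain ⟨z, hz⟩ := hb
      have hle (i) : I.A.mulVec x i ≤ I.A.mulVec z i := by
        rw [← ofRat_le_ofRat, ← hρ b z i hz]
        exact hx i
      -- The rows for `xⱼ` and `-xⱼ` bound each coordinate from both sides by that of `z`.
      have hxz : x = z := by
        funext j
        obtain ⟨⟨i₁, h₁⟩, i₂, h₂⟩ := hA.2 j
        have e₁ := hle i₁
        have e₂ := hle i₂
        simp only [Matrix.mulVec, h₁, h₂, single_dotProduct] at e₁ e₂
        linarith
      rwa [hxz]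
    · intro hx i
      exact (hρ b x i hx).ge
  refine ⟨ρ, ⟨⟨?_, ?_⟩, ?_⟩, hex⟩
  · rw [hex]; exact .refl
  · rw [hex]; exact fun s t hs hst => hs.tail hst
  -- Any inductive invariant contains the reachable states, so its bounds dominate those of the
  -- reachable point. Elsewhere `ρ` is the least element.
  · intro ρ' hρ' b i
    by_cases hb : ∃ x, (b, x) ∈ I.prog.reachable
    · obtain ⟨x, hx⟩ := hb
      rw [hρ b x i hx]
      have : (b, x) ∈ concretization I.A ρ' := by
        refine Relation.ReflTransGen.rec (motive := fun s _ => s ∈ concretization I.A ρ')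
          hρ'.1 ?_ hx
        exact fun _ hst hs => hρ'.2 _ _ hs hst
      exact this i
    · simp [ρ, dif_neg hb]

namespace Decider

variable (D : Decider) (M : ℕ) (w : List Bool)

theorem inst_leastInvariant : ∃ ρ, (D.inst M w).IsLeastInvariant ρ ∧
    concretization (D.inst M w).A ρ = (D.inst M w).prog.reachable :=
  exists_exact_leastInvariant _ D.isIntervalTemplate (by simp [inst]) fun _ hs _ ht h =>
    D.reachable_ext hs ht (congrArg Counter.read h)

/-- Correctness of the reduction. -/
theorem mem_iff_bad_not_mem {P : Polynomial ℕ} {L : Language Bool}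
    (h : D.DecidesInTime L fun n => 2 ^ P.eval n) :
    w ∈ L ↔ (D.inst (P.eval w.length + 1) w).bad ∉
      (D.program (P.eval w.length + 1) w).reachable := by
  obtain ⟨c, ⟨hT⟩, hc, hL⟩ := h w
  have hle : hT.steps ≤ 2 ^ P.eval w.length := hT.steps_le_m
  have := Nat.one_le_two_pow (n := P.eval w.length)
  -- There are `P + 2` counter bits, and `T + 1 ≤ 2 ^ P + 1 < 2 ^ (P + 2)`. One bit less would fail
  -- for `P = 0` and `T = 1`.
  rw [D.bad_mem_reachable_iff (T := hT.steps) hT.evals_in_steps hc (by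
    rw [pow_succ, pow_succ]; omega), not_not, hL]

end Decider

end PartitionedTemplates

namespace PartitionedTemplates

open Function Turing

/-! ### The code of the instance -/

/-- A string with holes, with the holes filled by `j` ones. -/
def expand (j : ℕ) (l : List (Option Token)) : List Token :=
  l.flatMap fun o => o.elim (List.replicate j .one) fun t => [t]

theorem expand_append (j : ℕ) (l l' : List (Option Token)) :
    expand j (l ++ l') = expand j l ++ expand j l' := List.flatMap_append

theorem expand_some_cons (j : ℕ) (t : Token) (l : List (Option Token)) :
    expand j (some t :: l) = t :: expand j l := rfl

theorem expand_none_cons (j : ℕ) (l : List (Option Token)) :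
    expand j (none :: l) = List.replicate j .one ++ expand j l := rfl

/-- The unary code of the sum of `K` and the index. -/
def indexTemplate (K : ℕ) : List (Option Token) :=
  List.replicate K (some .one) ++ [none, some .sep]

theorem expand_indexTemplate (K j : ℕ) : expand j (indexTemplate K) = encUnary (K + j) := by
  have h : expand j (List.replicate K (some .one)) = List.replicate K Token.one := by
    induction K with
    | zero => rfl
    | succ K ih => rw [List.replicate_succ, expand_some_cons, ih, List.replicate_succ]
  rw [indexTemplate, expand_append, h, expand_none_cons, encUnary, List.replicate_add,
    List.append_assoc]
  rfl

/-- Literals whose index is given by a template. -/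
def litTemplate (K : ℕ) (sign v : Token) : List (Option Token) :=
  some sign :: some v :: indexTemplate K

theorem expand_litTemplate (K j : ℕ) (sign v : Token) :
    expand j (litTemplate K sign v) = sign :: v :: encUnary (K + j) := by
  rw [litTemplate, expand_some_cons, expand_some_cons, expand_indexTemplate]

/-- The template for the codes of the formulas `Counter.gate`. -/
def gateTemplate (K : ℕ) : List (Option Token) :=
  let l := litTemplate K
  let r := litTemplate (K + 1)
  [some .or, some .and, some .and] ++ l .pos .pre ++ l .neg .post ++
    [some .or, some .and] ++ r .pos .pre ++ r .neg .post ++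
    [some .and] ++ r .neg .pre ++ r .pos .post ++
    [some .and, some .or] ++ l .neg .pre ++ l .pos .post ++
    [some .or, some .and] ++ r .pos .pre ++ r .pos .post ++
    [some .and] ++ r .neg .pre ++ r .neg .post

/-- The template for the code of the formula `Counter.noOverflow`. -/
def noOverflowTemplate (K : ℕ) : List (Option Token) :=
  some .or :: (litTemplate K .neg .pre ++ litTemplate K .pos .post)

namespace Counter

variable {nx ny np K M : ℕ}

/-- All indices in the gate are `K + j` or `K + 1 + j`. In unary the gates for different `j` are
therefore one fixed string with `j` ones inserted at fixed places. -/
theorem encFormula_gate (j : ℕ) (h : j + 1 < M + 1) :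
    encFormula (gate ⟨j, by omega⟩ ⟨j + 1, h⟩ : Formula (K + (M + 1)) nx ny np) =
      expand j (gateTemplate K) := by
  have e : K + (j + 1) = K + 1 + j := by ring
  simp only [gateTemplate, expand_append, expand_some_cons, expand_litTemplate, gate,
    encFormula, encBoolVar, old, new, e, List.append_assoc, List.cons_append, List.nil_append,
    Fin.val_natAdd]

theorem encFormula_noOverflow :
    encFormula (noOverflow : Formula (K + (M + 1)) nx ny np) =
      expand M (noOverflowTemplate K) := by
  simp [noOverflowTemplate, expand_append, expand_some_cons, expand_litTemplate, noOverflow,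
    encFormula, encBoolVar, old, new]

/-- The code of the formula `Counter.increment`. -/
def incrementCode (K : ℕ) : ℕ → List Token
  | 0 => [.or, .and, .pos, .pre] ++ encUnary K ++ [.neg, .post] ++ encUnary K ++
      [.and, .neg, .pre] ++ encUnary K ++ [.pos, .post] ++ encUnary K
  | j + 1 => .and :: (expand j (gateTemplate K) ++ incrementCode K j)

theorem encFormula_increment (j : ℕ) (h : j < M + 1) :
    encFormula (increment j h : Formula (K + (M + 1)) nx ny np) = incrementCode K j := by
  induction j with
  | zero => simp [increment, encFormula, encBoolVar, old, new, incrementCode]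
  | succ j ih => rw [increment, encFormula, encFormula_gate, ih, incrementCode]

theorem length_increment (j : ℕ) (h : j < M + 1) :
    (increment j h : Formula (K + (M + 1)) nx ny np).length = 24 * j + 7 := by
  induction j with
  | zero => rfl
  | succ j ih =>
    have hg (a b : Fin (M + 1)) : (gate a b : Formula (K + (M + 1)) nx ny np).length = 23 := rfl
    rw [increment, Formula.length, ih, hg]
    ring

theorem length_formula : (formula K M : Formula (K + (M + 1)) nx ny np).length = 24 * M + 11 := by
  rw [formula, Formula.length, length_increment]
  simp only [noOverflow, Formula.length]
  ring

end Counter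

namespace Decider

open Formula Counter

variable (D : Decider) (M : ℕ) (w : List Bool)

/-- `M` enters only through the type: control variables come before the counter bits, so their
indices do not move when counter bits are added. The control part is thus a constant string that the
reduction can write out, and its length is a constant. -/
theorem caseFormula_independent (c : D.Case) :
    encFormula (D.caseFormula M c) = encFormula (D.caseFormula 0 c) ∧
      (D.caseFormula M c).length = (D.caseFormula 0 c).length := by
  unfold caseFormula
  cases D.rule c with
  | none => exact ⟨rfl, rfl⟩
  | some u =>
    have hconj {nb nb' : ℕ} {l : List (Formula nb 2 0 D.caseCard)}
        {l' : List (Formula nb' 2 0 D.caseCard)} {G : Formula nb 2 0 D.caseCard}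
        {G' : Formula nb' 2 0 D.caseCard}
        (h : List.Forall₂ (fun F F' => encFormula F = encFormula F' ∧ F.length = F'.length) l l')
        (hG : encFormula G = encFormula G' ∧ G.length = G'.length) :
        encFormula (conj l G) = encFormula (conj l' G') ∧
          (conj l G).length = (conj l' G').length := by
      induction h with
      | nil => exact hG
      | @cons F F' l l' hF _ ih =>
        change encFormula (.and F (conj l G)) = encFormula (.and F' (conj l' G')) ∧
          (Formula.and F (conj l G)).length = (Formula.and F' (conj l' G')).length
        simp only [encFormula, Formula.length, hF.1, hF.2, ih.1, ih.2, and_self]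
    have hlit {v : BoolVar (D.controlCard + (M + 1)) D.caseCard}
        {v' : BoolVar (D.controlCard + (0 + 1)) D.caseCard} (b : Bool)
        (h : encBoolVar v = encBoolVar v') :
        encFormula (lit v b : Formula _ 2 0 _) = encFormula (lit v' b : Formula _ 2 0 _) ∧
          (lit v b : Formula _ 2 0 _).length = (lit v' b : Formula _ 2 0 _).length := by
      cases b <;> simp [encFormula, Formula.length, h]
    refine hconj (List.rel_append (List.rel_append (List.rel_append (List.rel_append ?_ ?_) ?_) ?_) ?_)
      ⟨rfl, rfl⟩
    · simp only [controlBefore, List.forall₂_map_left_iff, List.forall₂_map_right_iff]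
      exact List.forall₂_same.2 fun i _ => hlit _ rfl
    · simp only [controlAfter, List.forall₂_map_left_iff, List.forall₂_map_right_iff]
      exact List.forall₂_same.2 fun i _ => hlit _ rfl
    · exact .cons ⟨rfl, rfl⟩ (.cons ⟨rfl, rfl⟩ .nil)
    · exact .cons ⟨rfl, rfl⟩ (.cons ⟨rfl, rfl⟩ .nil)
    · exact .cons ⟨rfl, rfl⟩ .nil

theorem controlFormula_independent :
    encFormula (D.controlFormula M) = encFormula (D.controlFormula 0) ∧
      (D.controlFormula M).length = (D.controlFormula 0).length := by
  unfold controlFormula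
  induction List.finRange D.caseCard with
  | nil => exact ⟨rfl, rfl⟩
  | cons i l ih =>
    have h := D.caseFormula_independent M ((Finite.equivFin D.Case).symm i)
    simp only [select, encFormula, Formula.length, encBoolVar, h.1, h.2, ih.1, ih.2, and_self]

theorem encVec_boolState (q : D.Control) (i : ℕ) : encVec encBool (D.boolState M q i) =
    encVec encBool (D.controlBits q) ++ encVec encBool (bits (M + 1) i) := by
  rw [encVec, boolState, List.ofFn_fin_append, List.flatMap_append]
  rfl

theorem encVec_const {m : ℕ} {c : Fin m → Bool} {b : Bool} (h : ∀ i, c i = b) :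
    encVec encBool c = List.replicate m (if b then .one else .zero) := by
  have : c = fun _ => b := funext h
  rw [this, encVec, List.ofFn_const]
  clear this h c
  induction m with
  | zero => rfl
  | succ m ih => rw [List.replicate_succ, List.flatMap_cons, ih]; rfl

/-- The digits of the initial tape as a string. -/
noncomputable def wordCode : List Token := (D.wordBits w).flatMap encBool

theorem encRat_word : encRat (D.fracList (w.map fun b => some (.inl b))) =
    .pos :: (D.wordCode w ++ .sep :: (List.replicate (D.width * w.length) .zero ++
      [.one, .sep])) := by
  have hz (k : ℕ) : (List.replicate k false).flatMap encBool = List.replicate k Token.zero := by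
    induction k with
    | zero => rfl
    | succ k ih => rw [List.replicate_succ, List.flatMap_cons, ih]; rfl
  simp only [encRat, num_word, den_word, encBinary, Int.natAbs_natCast, bits_wordBits,
    bits_two_pow, List.flatMap_append, hz, wordCode]
  rw [if_neg (by simp)]
  simp [encBool]

/-- The constant part of the code before the counter formula. -/
noncomputable def codeFormula : List Token :=
  .sep :: (encUnary 2 ++ (encUnary 0 ++ (encUnary D.caseCard ++
    (.and :: (encFormula (D.controlFormula 0) ++ [.and])))))

/-- The constant part of the code after the word. -/
noncomputable def codeTemplate : List Token :=
  encUnary 4 ++ (encVec (encVec encRat) (D.inst 0 []).A ++ encVec encBool (D.controlBits none))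

/-- The code of the instance. -/
theorem encInstance_inst : encInstance (D.inst M w) =
    List.replicate (D.controlCard + 1) .one ++ (List.replicate M .one ++ (D.codeFormula ++
    (expand M (noOverflowTemplate D.controlCard) ++ (incrementCode D.controlCard M ++
    (encVec encBool (D.controlBits (some default)) ++ ([.zero] ++ (List.replicate M .zero ++
    ((encRat 0 ++ [.pos]) ++ (D.wordCode w ++ ([.sep] ++
    (List.replicate (D.width * w.length) .zero ++ ([.one, .sep] ++ (D.codeTemplate ++
    ([.one] ++ (List.replicate M .one ++ (encRat 0 ++ encRat 0)))))))))))))))) := by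
  have h0 : encVec encBool (bits (M + 1) 0) = [.zero] ++ List.replicate M .zero := by
    rw [encVec_const (b := false) fun i => by simp [bits]]
    rfl
  have h1 : encVec encBool (bits (M + 1) (2 ^ (M + 1) - 1)) =
      [.one] ++ List.replicate M .one := by
    rw [encVec_const (b := true) fun i => by simp [bits, Nat.testBit_two_pow_sub_one]; omega]
    rfl
  -- The `M` ones are separated from the constant ones because they are written by a loop.
  have hnb : encUnary (D.controlCard + (M + 1)) =
      List.replicate (D.controlCard + 1) .one ++ (List.replicate M .one ++ [.sep]) := by
    rw [encUnary, ← List.append_assoc, List.replicate_append_replicate]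
    congr 2
    omega
  have hx : encVec encRat (![0, D.fracList (w.map fun b => some (.inl b))] : Fin 2 → ℚ) =
      encRat 0 ++ encRat (D.fracList (w.map fun b => some (.inl b))) := by
    simp [encVec]
  have hbad : encVec encRat (0 : Fin 2 → ℚ) = encRat 0 ++ encRat 0 := by
    simp [encVec]
  have hT : encFormula (D.program M w).T =
      .and :: (encFormula (D.controlFormula 0) ++ ([.and] ++
        (expand M (noOverflowTemplate D.controlCard) ++ incrementCode D.controlCard M))) := by
    simp only [program, encFormula, (D.controlFormula_independent M).1, Counter.formula,
      encFormula_noOverflow, encFormula_increment]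
    rfl
  have hI : encInstance (D.inst M w) =
      (encUnary (D.controlCard + (M + 1)) ++ (encUnary 2 ++ (encUnary 0 ++ (encUnary D.caseCard ++
        (encFormula (D.program M w).T ++ (encVec encBool (D.boolState M (some default) 0) ++
        encVec encRat (![0, D.fracList (w.map fun b => some (.inl b))] : Fin 2 → ℚ))))))) ++
      (encUnary 4 ++ (encVec (encVec encRat) (D.inst 0 []).A ++
        (encVec encBool (D.boolState M none (2 ^ (M + 1) - 1)) ++
          encVec encRat (0 : Fin 2 → ℚ)))) := rfl
  rw [hI, hT, hnb, hx, hbad, encVec_boolState, encVec_boolState, h0, h1, encRat_word, codeFormula,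
    codeTemplate]
  simp only [List.append_assoc, List.cons_append, List.nil_append]

/-- The length of the instance. -/
theorem length_inst : (D.inst M w).length ≤
    3 * D.controlCard + D.caseCard + (D.controlFormula 0).length + 100 + 27 * M +
      2 * D.width * w.length := by
  have hnum : Nat.size (natOfBits (D.wordBits w)) ≤ D.width * w.length := by
    rw [Nat.size_le, ← D.length_wordBits]
    exact natOfBits_lt _
  have hA : ∑ i : Fin 4, ∑ j : Fin 2, ratLength ((D.inst 0 []).A i j) = 20 := by
    simp [inst, Fin.sum_univ_succ, ratLength, Pi.single_apply]
  have hx : ∑ i : Fin 2, ratLength ((D.program M w).x₀ i) ≤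
      5 + 2 * D.width * w.length := by
    have : ∑ i : Fin 2, ratLength ((D.program M w).x₀ i) =
        ratLength 0 + ratLength (D.fracList (w.map fun b => some (.inl b))) := Fin.sum_univ_two _
    rw [this]
    simp only [ratLength, num_word, den_word, Int.natAbs_natCast, Nat.size_pow]
    simp
    linarith
  have hbad : ∑ i : Fin 2, ratLength ((0 : Fin 2 → ℚ) i) = 4 := by
    simp [ratLength]
  have hT : (D.program M w).T.length = 1 + (D.controlFormula 0).length + (24 * M + 11) := by
    rw [← (D.controlFormula_independent M).2, ← length_formula]
    rfl
  have hI : (D.inst M w).length = ((D.controlCard + (M + 1)) + 2 + 0 + D.caseCard +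
      (D.program M w).T.length + (D.controlCard + (M + 1)) +
      ∑ i : Fin 2, ratLength ((D.program M w).x₀ i)) + 4 +
      (∑ i : Fin 4, ∑ j : Fin 2, ratLength ((D.inst 0 []).A i j)) + (D.controlCard + (M + 1)) +
      ∑ i : Fin 2, ratLength ((0 : Fin 2 → ℚ) i) := rfl
  rw [hI, hT, hA, hbad]
  -- The coefficient `27` consists of `24` from the counter formula and `3` from the three places
  -- where the number of Boolean variables is counted. The numerator and the denominator of the
  -- input fraction each contribute `width * |w|`.
  omega

end Decider

end PartitionedTemplates

/-! ### Time and effect of loops that only push -/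

namespace StackProgram

open Function

namespace Cmd

variable {K : Type} [DecidableEq K] {Γ : K → Type}

theorem Runs.congr {c : Cmd Γ} {t u : ℕ} {S S₁ S₂ : ∀ k, List (Γ k)} (h : Runs c t S S₁)
    (hS : S₁ = S₂) (ht : t = u) : Runs c u S S₂ := hS ▸ ht ▸ h

/-- Push a list of symbols, the first one last. -/
def pushAll : List (Σ k, Γ k) → Cmd Γ
  | [] => skip
  | p :: L => seq (pushAll L) (push p.1 p.2)

/-- The symbols for stack `k` in a list. -/
def component (k : K) : List (Σ k, Γ k) → List (Γ k)
  | [] => []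
  | p :: L => if h : p.1 = k then (h ▸ p.2) :: component k L else component k L

theorem component_map_mk_self (k : K) (l : List (Γ k)) : component k (l.map (Sigma.mk k)) = l := by
  induction l with
  | nil => rfl
  | cons g l ih => simp [component, ih]

theorem component_map_mk_of_ne {j k : K} (h : k ≠ j) (l : List (Γ k)) :
    component j (l.map (Sigma.mk k)) = [] := by
  induction l with
  | nil => rfl
  | cons g l ih => simp [component, ih, h]

theorem runs_pushAll (L : List (Σ k, Γ k)) (S : ∀ k, List (Γ k)) :
    Runs (pushAll L) (L.length + 1) S (fun k => component k L ++ S k) := by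
  induction L with
  | nil => exact .skip S
  | cons p L ih =>
    refine (ih.seq (.push _ p.1 p.2)).congr (funext fun k => ?_) rfl
    by_cases h : p.1 = k
    · subst h; simp [component]
    · simp [component, h, Ne.symm h]

/-- A loop whose body only pushes, and not on the stack of the loop. -/
theorem runs_forEach_pushAll {k : K} {L : Γ k → List (Σ k, Γ k)} {t : ℕ}
    (ht : ∀ g, (L g).length ≤ t) (hL : ∀ g, component k (L g) = []) {l : List (Γ k)}
    {S : ∀ k, List (Γ k)} (hS : S k = l) :
    Runs (forEach k fun g => pushAll (L g)) (l.length * (t + 2) + 1) S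
      (update (fun j => l.reverse.flatMap (fun g => component j (L g)) ++ S j) k []) := by
  induction l generalizing S with
  | nil =>
    refine (Runs.forEach_nil hS).congr (funext fun j => ?_) (by simp)
    by_cases h : j = k
    · subst h; simp [hS]
    · simp [h]
  -- The first symbol popped contributes the lowest part of the other stacks, hence the reversal. A
  -- round costs at most `t + 1` for the body and `1` for the pop.
  | cons g l ih =>
    have h1 := (runs_pushAll (L g) (update S k l)).mono
      (show (L g).length + 1 ≤ t + 1 by have := ht g; omega)
    refine (Runs.forEach_cons hS h1 (ih (by simp [hL]))).congr (funext fun j => ?_) ?_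
    · by_cases h : j = k
      · subst h; simp
      · simp [h]
    · rw [List.length_cons]
      ring

end Cmd

end StackProgram

namespace PartitionedTemplates

/-! ### Stack programs for the reduction -/

namespace Reduction

open Function StackProgram StackProgram.Cmd

/-- The stacks: input, output, a copy of the word, and numbers in unary. -/
inductive Stk
  | inp
  | out
  | word
  | len
  | len'
  | acc
  | tmp
  | idx
  | idx'
  deriving DecidableEq

instance : Fintype Stk where
  elems := {.inp, .out, .word, .len, .len', .acc, .tmp, .idx, .idx'}
  complete := by intro a; cases a <;> simp

/-- The stack alphabets. -/
abbrev Alph : Stk → Type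
  | .inp => Bool
  | _ => Token

instance (k : Stk) : Fintype (Alph k) := by
  cases k <;> (unfold Alph; infer_instance)

/-- The number `m` in unary. -/
abbrev un (m : ℕ) : List Token := List.replicate m .one

/-- The stacks, given their contents. -/
def store (inp : List Bool) (out word len len' acc tmp idx idx' : List Token) :
    ∀ k, List (Alph k)
  | .inp => inp
  | .out => out
  | .word => word
  | .len => len
  | .len' => len'
  | .acc => acc
  | .tmp => tmp
  | .idx => idx
  | .idx' => idx'

/-- Stack programs. -/
abbrev Prog := Cmd Alph

/-- Symbols to push on the output. -/
def outs (s : List Token) : List (Σ k, Alph k) := s.map (Sigma.mk (β := Alph) .out)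

theorem component_outs_out (s : List Token) : component .out (outs s) = s :=
  component_map_mk_self (Γ := Alph) _ _

theorem component_outs {k : Stk} (h : .out ≠ k) (s : List Token) : component k (outs s) = [] :=
  component_map_mk_of_ne (Γ := Alph) h _

/-- Prepend a string to the output. -/
def emit (s : List Token) : Prog := pushAll (outs s)

variable {inp : List Bool} {out word len len' acc tmp idx idx' : List Token}

theorem runs_emit (s : List Token) : Runs (emit s) (s.length + 1)
    (store inp out word len len' acc tmp idx idx')
    (store inp (s ++ out) word len len' acc tmp idx idx') := by
  refine (runs_pushAll _ _).congr (funext fun k => ?_) (by simp [outs])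
  cases k
  case out => rw [component_outs_out]; rfl
  all_goals rw [component_outs (by simp)]; rfl

theorem flatMap_replicate {α : Type} (m k : ℕ) (x : α) (t : Token) :
    (List.replicate m x).flatMap (fun _ => List.replicate k t) = List.replicate (k * m) t := by
  induction m with
  | zero => simp
  | succ m ih => rw [List.replicate_succ, List.flatMap_cons, ih, List.replicate_append_replicate]
                 congr 1; ring

/-! ### Reading the input -/

/-- Compute the length of the input. -/
def readInput : Prog :=
  -- The word is moved to `word` and back. Each move reverses it, so the input is restored for later
  -- use.
  seq (forEach .inp fun b => pushAll [⟨.word, if b then .one else .zero⟩, ⟨.len, .one⟩])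
    (forEach .word fun t => pushAll [⟨.inp, decide (t = .one)⟩])

theorem runs_readInput (w : List Bool) : Runs readInput (w.length * 7 + 2)
    (store w [] [] [] [] [] [] [] []) (store w [] [] (un w.length) [] [] [] [] []) := by
  have h1 : Runs (forEach .inp fun b => pushAll (Γ := Alph)
      [⟨.word, if b then .one else .zero⟩, ⟨.len, .one⟩]) (w.length * 4 + 1)
      (store w [] [] [] [] [] [] [] [])
      (store [] [] (w.reverse.map fun b => if b then .one else .zero) (un w.length)
        [] [] [] [] []) := by
    refine (runs_forEach_pushAll (l := w) (t := 2) (by simp) (by simp [component]) rfl).congr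
      (funext fun k => ?_) rfl
    cases k <;> simp [component, store, ← List.map_eq_flatMap]
  have h2 : Runs (forEach .word fun t => pushAll (Γ := Alph) [⟨.inp, decide (t = Token.one)⟩])
      (w.length * 3 + 1)
      (store [] [] (w.reverse.map fun b => if b then .one else .zero) (un w.length)
        [] [] [] [] [])
      (store w [] [] (un w.length) [] [] [] [] []) := by
    refine (runs_forEach_pushAll (l := w.reverse.map fun b => if b then .one else .zero) (t := 1)
      (by simp) (by simp [component]) rfl).congr (funext fun k => ?_) (by simp)
    cases k <;> simp [component, store, ← List.map_eq_flatMap]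
    refine (List.map_congr_left fun b _ => ?_).trans (List.map_id w)
    cases b <;> rfl
  exact (h1.seq h2).congr rfl (by ring)

/-! ### Evaluating a polynomial -/

/-- Multiplication by the length of the input. -/
def mulLen : Prog :=
  -- For each unit in `acc`, the length is emptied into `tmp` and `len'` and then restored from
  -- `len'`, so `tmp` collects the product by repeated addition.
  seq (forEach .acc fun _ =>
      seq (forEach .len fun _ => pushAll [⟨.tmp, .one⟩, ⟨.len', .one⟩])
        (forEach .len' fun _ => pushAll [⟨.len, .one⟩]))
    (forEach .tmp fun _ => pushAll [⟨.acc, .one⟩])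

theorem runs_mulLen (n a : ℕ) : Runs mulLen (a * (7 * n + 3) + 1 + (a * n * 3 + 1))
    (store inp out word (un n) [] (un a) [] idx idx')
    (store inp out word (un n) [] (un (a * n)) [] idx idx') := by
  have h1 (a b : ℕ) : Runs (forEach .len fun _ => pushAll (Γ := Alph)
      [⟨.tmp, Token.one⟩, ⟨.len', Token.one⟩]) (n * 4 + 1)
      (store inp out word (un n) [] (un a) (un b) idx idx')
      (store inp out word [] (un n) (un a) (un (n + b)) idx idx') := by
    refine (runs_forEach_pushAll (l := un n) (t := 2) (by simp) (by simp [component]) rfl).congr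
      (funext fun k => ?_) (by simp)
    cases k <;> simp [component, store, ← List.map_eq_flatMap]
  have h2 (a b : ℕ) : Runs (forEach .len' fun _ => pushAll (Γ := Alph)
      [⟨.len, Token.one⟩]) (n * 3 + 1)
      (store inp out word [] (un n) (un a) (un b) idx idx')
      (store inp out word (un n) [] (un a) (un b) idx idx') := by
    refine (runs_forEach_pushAll (l := un n) (t := 1) (by simp) (by simp [component]) rfl).congr
      (funext fun k => ?_) (by simp)
    cases k <;> simp [component, store, ← List.map_eq_flatMap]
  have h3 (m : ℕ) : Runs (forEach .tmp fun _ => pushAll (Γ := Alph)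
      [⟨.acc, Token.one⟩]) (m * 3 + 1)
      (store inp out word (un n) [] [] (un m) idx idx')
      (store inp out word (un n) [] (un m) [] idx idx') := by
    refine (runs_forEach_pushAll (l := un m) (t := 1) (by simp) (by simp [component]) rfl).congr
      (funext fun k => ?_) (by simp)
    cases k <;> simp [component, store, ← List.map_eq_flatMap]
  have h4 (b : ℕ) : Runs (forEach .acc fun _ =>
      seq (forEach .len fun _ => pushAll (Γ := Alph) [⟨.tmp, Token.one⟩, ⟨.len', Token.one⟩])
        (forEach .len' fun _ => pushAll (Γ := Alph) [⟨.len, Token.one⟩])) (a * (7 * n + 3) + 1)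
      (store inp out word (un n) [] (un a) (un b) idx idx')
      (store inp out word (un n) [] [] (un (a * n + b)) idx idx') := by
    induction a generalizing b with
    | zero => exact (Runs.forEach_nil rfl).congr (by simp) (by simp)
    | succ a ih =>
      have e : update (store inp out word (un n) [] (un (a + 1)) (un b) idx idx') .acc (un a) =
          store inp out word (un n) [] (un a) (un b) idx idx' := by
        funext k; cases k <;> simp [store]
      refine (Runs.forEach_cons (g := Token.one) (r := un a) rfl
        (e ▸ (h1 a b).seq (h2 a (n + b))) (ih (n + b))).congr ?_ (by ring)
      congr 2
      ring
  exact (h4 0).seq (h3 (a * n))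

/-- Horner's scheme: adding a coefficient is pushing a fixed number of ones, multiplying by the
variable is `mulLen`. The polynomial time bound is built along with the program. -/
theorem exists_runs_poly (P : Polynomial ℕ) : ∃ (c : Prog) (q : Polynomial ℕ),
    ∀ (n : ℕ) (inp : List Bool) (out word idx idx' : List Token), Runs c (q.eval n)
      (store inp out word (un n) [] [] [] idx idx')
      (store inp out word (un n) [] (un (P.eval n)) [] idx idx') := by
  induction P using Polynomial.recOnHorner with
  | M0 => exact ⟨skip, 1, fun n inp out word idx idx' => (Runs.skip _).congr (by simp) (by simp)⟩
  | MC P a _ _ ih =>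
    obtain ⟨c, q, h⟩ := ih
    refine ⟨seq c (pushAll (List.replicate a ⟨.acc, Token.one⟩)), q + Polynomial.C (a + 1),
      fun n inp out word idx idx' => ((h n inp out word idx idx').seq (runs_pushAll _ _)).congr
        (funext fun k => ?_) (by simp)⟩
    have h1 : component .acc (List.replicate a (⟨.acc, Token.one⟩ : Σ k, Alph k)) = un a := by
      rw [← List.map_replicate (f := Sigma.mk (β := Alph) .acc), component_map_mk_self]
    have h2 {k : Stk} (hk : .acc ≠ k) :
        component k (List.replicate a (⟨.acc, Token.one⟩ : Σ k, Alph k)) = [] := by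
      rw [← List.map_replicate (f := Sigma.mk (β := Alph) .acc),
        component_map_mk_of_ne (Γ := Alph) hk]
    cases k
    case acc => rw [h1]; simp [store, add_comm]
    all_goals rw [h2 (by simp)]; rfl
  | MX P _ ih =>
    obtain ⟨c, q, h⟩ := ih
    exact ⟨seq c mulLen, q + (P * (7 * Polynomial.X + 3) + 1 + (P * Polynomial.X * 3 + 1)),
      fun n inp out word idx idx' => ((h n inp out word idx idx').seq (runs_mulLen _ _)).congr
        (by simp) (by simp)⟩

/-! ### Writing the output -/

/-- Write ones, as many as the number in `acc`, and move this number to `tmp`. -/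
theorem runs_ones (m : ℕ) : Runs (forEach .acc fun _ => pushAll (⟨.tmp, .one⟩ :: outs [.one]))
    (m * 4 + 1) (store inp out word len len' (un m) [] idx idx')
    (store inp (un m ++ out) word len len' [] (un m) idx idx') := by
  refine (runs_forEach_pushAll (l := un m) (t := 2) (by simp [outs]) (by simp [component, outs])
    rfl).congr (funext fun k => ?_) (by simp)
  cases k <;> simp [component, store, outs, ← List.map_eq_flatMap]

/-- Write zeros, as many as the number in `tmp`, and move this number to `acc`. -/
theorem runs_zeros (m : ℕ) : Runs (forEach .tmp fun _ => pushAll (⟨.acc, .one⟩ :: outs [.zero]))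
    (m * 4 + 1) (store inp out word len len' [] (un m) idx idx')
    (store inp (List.replicate m .zero ++ out) word len len' (un m) [] idx idx') := by
  refine (runs_forEach_pushAll (l := un m) (t := 2) (by simp [outs]) (by simp [component, outs])
    rfl).congr (funext fun k => ?_) (by simp)
  cases k <;> simp [component, store, outs, ← List.map_eq_flatMap]

/-- Write the number in `idx`, and clear it. -/
theorem runs_finish (m : ℕ) : Runs (forEach .idx fun _ => emit [.one])
    (m * 3 + 1) (store inp out word len len' acc tmp (un m) idx')
    (store inp (un m ++ out) word len len' acc tmp [] idx') := by
  refine (runs_forEach_pushAll (l := un m) (t := 1) (by simp [outs]) (by simp [component, outs])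
    rfl).congr (funext fun k => ?_) (by simp)
  cases k <;> simp [component, store, outs, ← List.map_eq_flatMap]

/-- In binary the denominator `2 ^ (k * m)` begins with these zeros, least significant digit first.
-/
theorem runs_denominator (k m : ℕ) : Runs (forEach .len fun _ => emit (List.replicate k .zero))
    (m * (k + 2) + 1) (store inp out word (un m) len' acc tmp idx idx')
    (store inp (List.replicate (k * m) .zero ++ out) word [] len' acc tmp idx idx') := by
  refine (runs_forEach_pushAll (l := un m) (t := k) (by simp [outs])
    (fun _ => component_outs (by simp) _) rfl).congr (funext fun k => ?_) (by simp)
  cases k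
  case out => simp [component_outs_out, store, flatMap_replicate]
  all_goals simp [component_outs, store]

/-- The reversal caused by popping agrees with the order of blocks in `wordBits`, where the last
letter is the least significant. -/
theorem runs_word {s : Bool → List Token} {t : ℕ} (hs : ∀ b, (s b).length ≤ t) (w : List Bool) :
    Runs (forEach .inp fun b => emit (s b)) (w.length * (t + 2) + 1)
    (store w out word len len' acc tmp idx idx')
    (store [] (w.reverse.flatMap s ++ out) word len len' acc tmp idx idx') := by
  refine (runs_forEach_pushAll (l := w) (t := t) (by simpa [outs] using hs)
    (fun _ => component_outs (by simp) _) rfl).congr (funext fun k => ?_) (by simp)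
  cases k
  case out => simp [component_outs_out, store]
  all_goals simp [component_outs, store]

/-- Write the number in `idx`. -/
def emitIdx : Prog :=
  seq (forEach .idx fun _ => pushAll (⟨.idx', .one⟩ :: outs [.one]))
    (forEach .idx' fun _ => pushAll [⟨.idx, .one⟩])

theorem runs_emitIdx (j : ℕ) : Runs emitIdx (7 * j + 2)
    (store inp out word len len' acc tmp (un j) [])
    (store inp (un j ++ out) word len len' acc tmp (un j) []) := by
  have h1 : Runs (forEach .idx fun _ => pushAll (⟨.idx', .one⟩ :: outs [.one])) (j * 4 + 1)
      (store inp out word len len' acc tmp (un j) [])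
      (store inp (un j ++ out) word len len' acc tmp [] (un j)) := by
    refine (runs_forEach_pushAll (l := un j) (t := 2) (by simp [outs]) (by simp [component, outs])
      rfl).congr (funext fun k => ?_) (by simp)
    cases k <;> simp [component, store, outs, ← List.map_eq_flatMap]
  have h2 (out : List Token) : Runs (forEach .idx' fun _ => pushAll (Γ := Alph)
      [⟨.idx, Token.one⟩]) (j * 3 + 1)
      (store inp out word len len' acc tmp [] (un j))
      (store inp out word len len' acc tmp (un j) []) := by
    refine (runs_forEach_pushAll (l := un j) (t := 1) (by simp) (by simp [component])
      rfl).congr (funext fun k => ?_) (by simp)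
    cases k <;> simp [component, store, ← List.map_eq_flatMap]
  exact (h1.seq (h2 _)).congr rfl (by ring)

/-- Write a template with the number in `idx`. -/
def emitTemplate : List (Option Token) → Prog
  | [] => skip
  | some t :: l => seq (emitTemplate l) (emit [t])
  | none :: l => seq (emitTemplate l) emitIdx

theorem runs_emitTemplate (l : List (Option Token)) (j : ℕ) :
    Runs (emitTemplate l) (l.length * (7 * j + 2) + 1)
    (store inp out word len len' acc tmp (un j) [])
    (store inp (expand j l ++ out) word len len' acc tmp (un j) []) := by
  induction l with
  | nil => exact (Runs.skip _).congr rfl (by simp)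
  | cons o l ih =>
    rcases o with _ | t
    · refine (ih.seq (runs_emitIdx j)).congr ?_ (by rw [List.length_cons]; ring)
      rw [expand_none_cons, List.append_assoc]
    · refine ((ih.seq (runs_emit [t])).congr ?_ rfl).mono (by simp; linarith)
      rfl

/-- Write the counter formula. -/
def emitIncrement (K : ℕ) : Prog :=
  forEach .acc fun _ => seq (emitTemplate (gateTemplate K)) (pushAll (⟨.idx, .one⟩ :: outs [.and]))

/-- `acc` counts the gates still to be written and `idx` holds the index of the next one. Gates for
low bits are innermost at the end of the code, so writing backwards produces them in increasing
order. `N` bounds the index and hence the time of every round uniformly. -/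
theorem runs_emitIncrement (K : ℕ) {j m N : ℕ} (h : j + m ≤ N) : Runs (emitIncrement K)
    (m * ((gateTemplate K).length * (7 * N + 2) + 5) + 1)
    (store inp (Counter.incrementCode K j ++ out) word len len' (un m) tmp (un j) [])
    (store inp (Counter.incrementCode K (j + m) ++ out) word len len' [] tmp (un (j + m)) []) := by
  induction m generalizing j with
  | zero => exact (Runs.forEach_nil rfl).congr rfl (by simp)
  | succ m ih =>
    have e : update (store inp (Counter.incrementCode K j ++ out) word len len' (un (m + 1)) tmp
        (un j) []) .acc (un m) = store inp (Counter.incrementCode K j ++ out) word len len'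
        (un m) tmp (un j) [] := by
      funext k; cases k <;> simp [store]
    have h1 := runs_emitTemplate (inp := inp) (out := Counter.incrementCode K j ++ out)
      (word := word) (len := len) (len' := len') (acc := un m) (tmp := tmp) (gateTemplate K) j
    have h2 := (h1.seq (runs_pushAll (⟨.idx, .one⟩ :: outs [.and]) _)).congr (S₂ :=
      store inp (Counter.incrementCode K (j + 1) ++ out) word len len' (un m) tmp (un (j + 1)) [])
      (funext fun k => by cases k <;> simp [component, outs, store, Counter.incrementCode,
        List.replicate_succ]) rfl
    have h3 : (gateTemplate K).length * (7 * j + 2) ≤ (gateTemplate K).length * (7 * N + 2) :=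
      Nat.mul_le_mul_left _ (by omega)
    have h4 := ih (j := j + 1) (by omega)
    rw [show j + 1 + m = j + (m + 1) by ring] at h4
    refine (Runs.forEach_cons (g := Token.one) (r := un m) rfl (e ▸ h2) h4).mono ?_
    simp only [outs, List.map_cons, List.map_nil, List.length_cons, List.length_nil]
    linarith

end Reduction

end PartitionedTemplates

/-! ### The reduction runs in polynomial time -/

namespace PartitionedTemplates

namespace Decider

open Function StackProgram StackProgram.Cmd Reduction

variable (D : Decider)

theorem wordCode_eq (w : List Bool) :
    D.wordCode w = w.reverse.flatMap fun b => (D.symBits b).flatMap encBool := by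
  rw [wordCode, wordBits, List.flatMap_assoc]

/-- The program that writes the code of the instance, given a program for a polynomial. -/
noncomputable def writeInstance (c : Prog) : Prog :=
  -- The output is a stack, so the code is written from its end. The number `P(|w|) + 1` passes from
  -- `acc` to `tmp` while the full counter of the bad state is written, and back while the zero
  -- counter of the initial state is written. Writing the gates then turns it into `idx`, which
  -- serves the overflow formula and finally the number of Boolean variables.
  seq readInput <| seq c <|
  seq (emit (encRat 0 ++ encRat 0)) <|
  seq (forEach .acc fun _ => pushAll (⟨.tmp, .one⟩ :: outs [.one])) <|
  seq (emit ([.one, .sep] ++ (D.codeTemplate ++ [.one]))) <|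
  seq (forEach .len fun _ => emit (List.replicate D.width .zero)) <|
  seq (emit [.sep]) <|
  seq (forEach .inp fun b => emit ((D.symBits b).flatMap encBool)) <|
  seq (emit (encRat 0 ++ [.pos])) <|
  seq (forEach .tmp fun _ => pushAll (⟨.acc, .one⟩ :: outs [.zero])) <|
  seq (emit (Counter.incrementCode D.controlCard 0 ++
    (encVec encBool (D.controlBits (some default)) ++ [.zero]))) <|
  seq (emitIncrement D.controlCard) <|
  seq (emitTemplate (noOverflowTemplate D.controlCard)) <|
  seq (emit D.codeFormula) <|
  seq (forEach .idx fun _ => emit [.one]) (emit (List.replicate (D.controlCard + 1) .one))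

/-- The reduction is computable in polynomial time. -/
theorem polyTimeComputable_inst (P : Polynomial ℕ) :
    PolyTimeComputable fun w => D.inst (P.eval w.length + 1) w := by
  obtain ⟨c, q, hc⟩ := exists_runs_poly (P + 1)
  have hs (b : Bool) : ((D.symBits b).flatMap encBool).length ≤ D.width := by
    rw [List.length_flatMap, ← D.length_symBits b]
    simp [encBool]
  -- `t s` is the time of `emit s`; the bound below has one summand for each command of
  -- `writeInstance`, in the same order.
  let t (s : List Token) : Polynomial ℕ := ((s.length + 1 : ℕ) : Polynomial ℕ)
  let G : Polynomial ℕ := ((gateTemplate D.controlCard).length : Polynomial ℕ)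
  let O : Polynomial ℕ := ((noOverflowTemplate D.controlCard).length : Polynomial ℕ)
  let X : Polynomial ℕ := Polynomial.X
  let W : Polynomial ℕ := (D.width : Polynomial ℕ)
  let M : Polynomial ℕ := P + 1
  refine computableInPolyTime (Γ := Alph) .inp .out (D.writeInstance c) (Equiv.refl Bool)
    (Equiv.refl Token)
    (X * 7 + 2 + (q + (t (encRat 0 ++ encRat 0) + (M * 4 + 1 +
      (t ([.one, .sep] ++ (D.codeTemplate ++ [.one])) + (X * (W + 2) + 1 + (t [.sep] +
      (X * (W + 2) + 1 + (t (encRat 0 ++ [.pos]) + (M * 4 + 1 +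
      (t (Counter.incrementCode D.controlCard 0 ++
        (encVec encBool (D.controlBits (some default)) ++ [.zero])) +
      (M * (G * (7 * M + 2) + 5) + 1 + (O * (7 * M + 2) + 1 + (t D.codeFormula +
      (M * 3 + 1 + t (List.replicate (D.controlCard + 1) .one)))))))))))))))) fun w => ?_
  have hM : (P + 1).eval w.length = P.eval w.length + 1 := by simp
  set m := P.eval w.length + 1 with hm
  have h2 := hc w.length w [] [] [] []
  rw [hM] at h2
  have h12 := runs_emitIncrement (inp := []) (word := []) (len := []) (len' := []) (tmp := [])
    (out := encVec encBool (D.controlBits (some default)) ++ ([.zero] ++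
      (List.replicate m .zero ++ ((encRat 0 ++ [.pos]) ++ (D.wordCode w ++ ([.sep] ++
      (List.replicate (D.width * w.length) .zero ++ ([.one, .sep] ++ (D.codeTemplate ++
      ([.one] ++ (List.replicate m .one ++ (encRat 0 ++ encRat 0))))))))))))
    D.controlCard (j := 0) (m := m) (N := m) (by omega)
  rw [zero_add] at h12
  have hin : update (β := fun k => List (Alph k)) (fun _ => []) Stk.inp (List.map (Equiv.refl Bool).symm (id w)) =
      store w [] [] [] [] [] [] [] [] := by
    funext k; cases k <;> simp [store]
  have hout (s : List Token) : store [] s [] [] [] [] [] [] [] =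
      update (β := fun k => List (Alph k)) (fun _ => []) Stk.out (List.map (Equiv.refl Token).symm s) := by
    funext k; cases k <;> simp [store]
  rw [hin, ← hout, encInstance_inst]
  refine (((runs_readInput w).seq <| h2.seq <| (runs_emit _).seq <| (runs_ones m).seq <|
    (runs_emit _).seq <| (runs_denominator _ _).seq <| (runs_emit _).seq <|
    (runs_word hs w).seq <| (runs_emit _).seq <| (runs_zeros m).seq <|
    ((runs_emit _).congr ?_ rfl).seq <| h12.seq <| (runs_emitTemplate _ _).seq <|
    (runs_emit _).seq <| (runs_finish _).seq <| (runs_emit _)).congr rfl ?_)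
  · rw [wordCode_eq]
    simp only [List.append_assoc, List.append_nil]
    rfl
  · simp only [t, G, O, X, W, M, Polynomial.eval_add, Polynomial.eval_mul, Polynomial.eval_one,
      Polynomial.eval_ofNat, Polynomial.eval_X, Polynomial.eval_natCast, List.length_replicate, id_eq,
      Nat.cast_id, hm]

end Decider

/-- The properties of the reduction. -/
theorem exists_reduction (D : Decider) (P : Polynomial ℕ) (L : Language Bool)
    (hD : D.DecidesInTime L fun n => 2 ^ P.eval n) :
    ∃ (f : List Bool → AnalysisInstance) (k : ℕ),
      PolyTimeComputable f ∧
      ∀ w : List Bool,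
        (f w).length ≤ k * (P.eval w.length + w.length + 1) ∧
        (f w).prog.nb ≤ P.eval w.length + k ∧
        (f w).prog.nx = 2 ∧
        (f w).prog.ny = 0 ∧
        (f w).prog.T.Guarded ∧
        (f w).prog.Deterministic ∧
        (f w).prog.HasAffineUpdates k ∧
        (f w).prog.HasSeparatingCounter (P.eval w.length + k) ∧
        IsIntervalTemplate (f w).A ∧
        ∃ ρ, (f w).IsLeastInvariant ρ ∧
          concretization (f w).A ρ = (f w).prog.reachable ∧
          (w ∈ L ↔ (f w).bad ∉ concretization (f w).A ρ) := by
  set C := 3 * D.controlCard + D.caseCard + (D.controlFormula 0).length + 100 with hC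
  refine ⟨fun w => D.inst (P.eval w.length + 1) w, C + 2 * D.width + 27,
    D.polyTimeComputable_inst P, fun w => ⟨?_, ?_, rfl, rfl, D.guarded, D.deterministic, ?_, ?_,
      D.isIntervalTemplate, ?_⟩⟩
  · refine (D.length_inst _ w).trans ?_
    rw [← hC]
    nlinarith [Nat.zero_le (C * P.eval w.length), Nat.zero_le (C * w.length),
      Nat.zero_le (D.width * P.eval w.length), Nat.zero_le w.length]
  · change D.controlCard + (P.eval w.length + 1 + 1) ≤ _
    omega
  · obtain ⟨U, hU, h⟩ := D.hasAffineUpdates (M := P.eval w.length + 1) (w := w)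
    exact ⟨U, hU.trans (by omega), h⟩
  · obtain ⟨S, hS, h⟩ := D.hasSeparatingCounter (M := P.eval w.length + 1) (w := w)
    exact ⟨S, hS.trans (by omega), h⟩
  · obtain ⟨ρ, h1, h2⟩ := D.inst_leastInvariant (P.eval w.length + 1) w
    exact ⟨ρ, h1, h2, by rw [h2]; exact D.mem_iff_bad_not_mem w hD⟩

theorem concretization_mono {nb nx nrow : ℕ} (A : Matrix (Fin nrow) (Fin nx) ℚ)
    {ρ ρ' : AbstractValue nb nrow} (h : ρ ≤ ρ') : concretization A ρ ⊆ concretization A ρ' :=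
  fun s hs i => (hs i).trans (h s.1 i)

end PartitionedTemplates

/-! ### Hardness of the two decision problems -/

theorem mainTheorem3 :
    ExptimeHard LeastInvariantExcludesBad ∧
    ExptimeHard SomeInvariantExcludesBad ∧
    ∀ (D : Decider) (P : Polynomial ℕ) (L : Language Bool),
      D.DecidesInTime L (fun n => 2 ^ P.eval n) →
      ∃ (f : List Bool → AnalysisInstance) (k : ℕ),
        PolyTimeComputable f ∧
        ∀ w : List Bool,
          (f w).length ≤ k * (P.eval w.length + w.length + 1) ∧
          (f w).prog.nb ≤ P.eval w.length + k ∧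
          (f w).prog.nx = 2 ∧
          (f w).prog.ny = 0 ∧
          (f w).prog.T.Guarded ∧
          (f w).prog.Deterministic ∧
          (f w).prog.HasAffineUpdates k ∧
          (f w).prog.HasSeparatingCounter (P.eval w.length + k) ∧
          IsIntervalTemplate (f w).A ∧
          ∃ ρ, (f w).IsLeastInvariant ρ ∧
            concretization (f w).A ρ = (f w).prog.reachable ∧
            (w ∈ L ↔ (f w).bad ∉ concretization (f w).A ρ) := by
  refine ⟨?_, ?_, exists_reduction⟩
  · rintro L ⟨D, P, hD⟩
    obtain ⟨f, k, hf, h⟩ := exists_reduction D P L hD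
    refine ⟨f, hf, fun w => ?_⟩
    obtain ⟨-, -, -, -, -, -, -, -, -, ρ, hρ, -, hw⟩ := h w
    refine hw.trans ⟨fun hb => ⟨ρ, hρ, hb⟩, ?_⟩
    -- A least element is unique, so the witness is the exact invariant of the reduction.
    rintro ⟨ρ', hρ', hb⟩
    rwa [hρ.unique hρ']
  · rintro L ⟨D, P, hD⟩
    obtain ⟨f, k, hf, h⟩ := exists_reduction D P L hD
    refine ⟨f, hf, fun w => ?_⟩
    obtain ⟨-, -, -, -, -, -, -, -, -, ρ, hρ, -, hw⟩ := h w
    refine hw.trans ⟨fun hb => ⟨ρ, hρ.1, hb⟩, ?_⟩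
    rintro ⟨ρ', hρ', hb⟩
    -- If the least invariant contained the bad state, so would the larger invariant `ρ'`.
    exact fun hbad => hb (concretization_mono _ (hρ.2 hρ') hbad)
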